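/- **Setting.** Let $z_1,z_2,\dots$ be independent random variables such that $z_n$ is uniformly distributed on $\{1,\dots,n\}$. The *randomly grown prefix attachment graph* $G_n^{\rm pfx}$ is the simple graph on the nodes $1,\dots,n$ obtained as follows: at step $m=1,\dots,n$ the new node $m$ is born and is joined to the nodes $1,\dots,z_m-1$ (the same sequence $(z_m)$ is used for all $n$). Let $W^{\rm pfx}$ be the $0$-$1$ valued graphon on the probability space $[0,1]^2$ with the uniform measure given by $$W^{\rm pfx}\bigl((x_1,y_1),(x_2,y_2)\bigr)=\begin{cases}1,&\text{if } x_1<x_2y_2 \text{ or } x_2<x_1y_1,\\ 0,&\text{otherwise.}\end{cases}$$ **Notation.** A graphon on a probability space $(\Omega,\pi)$ is a symmetric measurable function $W:\Omega\times\Omega\to[0,1]$. For a finite simple graph $F$ put $$t(F,W)=\int_{\Omega^{V(F)}}\prod_{ij\in E(F)}W(x_i,x_j)\prod_{i\in V(F)}d\pi(x_i),$$ and for a graph $G$ put $t(F,G)=\hom(F,G)/|V(G)|^{|V(F)|}$, where $\hom(F,G)$ is the number of homomorphisms $F\to G$. For a graph $G$ on $\{1,\dots,n\}$, let $W_G$ be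 the graphon on $[0,1]$ (with Lebesgue measure) obtained by splitting $[0,1]$ into $n$ consecutive intervals $J_1,\dots,J_n$ of equal length and setting $W_G=1$ on $J_i\times J_j$ if $ij\in E(G)$ and $W_G=0$ on $J_i\times J_j$ otherwise. For graphons $U$ on $\Omega_1$ and $W$ on $\Omega_2$ let $$\delta_\square(U,W)=\inf_\phi\ \sup_{S,T\subseteq\Omega_1}\Bigl|\int_{S\times T}(U-W^\phi)\Bigr|,\qquad \delta_1(U,W)=\inf_\phi\int_{\Omega_1\times\Omega_1}|U-W^\phi|,$$ where $S,T$ range over measurable sets, $\phi$ ranges over the invertible maps $\Omega_1\to\Omega_2$ such that $\phi$ and $\phi^{-1}$ are measure preserving, and $W^\phi(x,y)=W(\phi(x),\phi(y))$. **Proposition.** With probability $1$, the graphs $G_n^{\rm pfx}$ converge to $W^{\rm pfx}$ as $n\to\infty$, in each of the following senses: 1. $t(F,G_n^{\rm pfx})\to t(F,W^{\rm pfx})$ for every finite simple graph $F$; 2. $\delta_\square(W_{G_n^{\rm pfx}},W^{\rm pfx})\to0$ (cut distance); 3. $\delta_1(W_{G_n^{\rm pfx}},W^{\rm pfx})\to0$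 (edit distance). -/

import Mathlib

open MeasureTheory ProbabilityTheory Filter Topology
open scoped ENNReal unitInterval

noncomputable section

/-- A graphon on the measurable space `α` (which carries a probability measure): a symmetric
measurable function `α × α → [0,1]`. -/
structure Graphon (α : Type*) [MeasurableSpace α] where
  /-- the underlying function of two variables -/
  toFun : α → α → ℝ
  measurable' : Measurable (fun p : α × α => toFun p.1 p.2)
  symm' : ∀ x y, toFun x y = toFun y x
  nonneg' : ∀ x y, 0 ≤ toFun x y
  le_one' : ∀ x y, toFun x y ≤ 1

/-- The cut norm `sup_{S,T} |∫_{S × T} W|`, over measurable sets `S`, `T`, as an element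
of `[0,∞]`. -/
def cutNorm {α : Type*} [MeasureSpace α] (W : α → α → ℝ) : ℝ≥0∞ :=
  ⨆ (S : Set α) (T : Set α) (_ : MeasurableSet S) (_ : MeasurableSet T),
    ENNReal.ofReal |∫ p in S ×ˢ T, W p.1 p.2|

/-- The norm `∫ |W|`, as an element of `[0,∞]`. -/
def oneNorm {α : Type*} [MeasureSpace α] (W : α → α → ℝ) : ℝ≥0∞ :=
  ∫⁻ p : α × α, ENNReal.ofReal |W p.1 p.2|

/-- The cut distance: the infimum of `‖U - W^φ‖_□`, where `W^φ (x, y) = W (φ x, φ y)`, over all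
invertible maps `φ` from the space of `U` to that of `W` such that `φ` and its inverse are measure
preserving. An infimum over the empty set would be `∞`. -/
def cutDist {α β : Type*} [MeasureSpace α] [MeasureSpace β] (U : Graphon α) (W : Graphon β) :
    ℝ≥0∞ :=
  ⨅ (φ : α ≃ᵐ β) (_ : MeasurePreserving φ volume volume),
    cutNorm (fun x y => U.toFun x y - W.toFun (φ x) (φ y))

/-- The edit distance: the infimum of `‖U - W^φ‖₁` over the same maps `φ`. -/
def editDist {α β : Type*} [MeasureSpace α] [MeasureSpace β] (U : Graphon α) (W : Graphon β) :
    ℝ≥0∞ :=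
  ⨅ (φ : α ≃ᵐ β) (_ : MeasurePreserving φ volume volume),
    oneNorm (fun x y => U.toFun x y - W.toFun (φ x) (φ y))

/-- The homomorphism density `t(F, G) = hom(F, G) / |V(G)| ^ |V(F)|`. -/
def homDensity {k n : ℕ} (F : SimpleGraph (Fin k)) (G : SimpleGraph (Fin n)) : ℝ :=
  (Nat.card (F →g G) : ℝ) / (n : ℝ) ^ k

open Classical in
/-- The homomorphism density `t(F, W) = ∫ ∏_{ij ∈ E(F)} W(x_i, x_j) dx` in a graphon. -/
def graphonDensity {k : ℕ} {α : Type*} [MeasureSpace α] (F : SimpleGraph (Fin k))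
    (W : Graphon α) : ℝ :=
  ∫ x : Fin k → α, ∏ e ∈ F.edgeFinset,
    Sym2.lift ⟨fun i j => W.toFun (x i) (x j), fun i j => W.symm' (x i) (x j)⟩ e

/-- The `i`-th of the `n` equal intervals into which `[0,1]` is split (`i = 0, …, n - 1`):
`[i/n, (i+1)/n)`, the last one being closed on the right. -/
def pixel (n : ℕ) (i : Fin n) : Set I :=
  {x | min ⌊(n : ℝ) * (x : ℝ)⌋₊ (n - 1) = (i : ℕ)}

theorem measurableSet_pixel (n : ℕ) (i : Fin n) : MeasurableSet (pixel n i) := by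
  have h : Measurable (fun x : I => min ⌊(n : ℝ) * (x : ℝ)⌋₊ (n - 1)) := by
    have h1 : Measurable (fun x : I => ⌊(n : ℝ) * (x : ℝ)⌋₊) :=
      Nat.measurable_floor.comp (measurable_subtype_coe.const_mul _)
    exact h1.min measurable_const
  exact h (measurableSet_singleton (i : ℕ))

open Classical in
/-- The graphon `W_G` on `[0,1]` of a finite simple graph `G`: it is `1` on the product of the
`i`-th and the `j`-th interval if `ij` is an edge of `G`, and `0` elsewhere. -/
def graphGraphon {n : ℕ} (G : SimpleGraph (Fin n)) : Graphon I where
  toFun x y := if ∃ i j, x ∈ pixel n i ∧ y ∈ pixel n j ∧ G.Adj i j then 1 else 0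
  measurable' := by
    refine Measurable.ite ?_ measurable_const measurable_const
    have : {p : I × I | ∃ i j, p.1 ∈ pixel n i ∧ p.2 ∈ pixel n j ∧ G.Adj i j} =
        ⋃ i, ⋃ j, ⋃ _ : G.Adj i j, pixel n i ×ˢ pixel n j := by
      ext p
      simp only [Set.mem_ofPred_eq, Set.mem_iUnion, Set.mem_prod]
      exact ⟨fun ⟨i, j, h1, h2, h3⟩ => ⟨i, j, h3, h1, h2⟩,
        fun ⟨i, j, h3, h1, h2⟩ => ⟨i, j, h1, h2, h3⟩⟩
    rw [this]
    exact MeasurableSet.iUnion fun i => MeasurableSet.iUnion fun j => MeasurableSet.iUnion fun _ =>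
      (measurableSet_pixel n i).prod (measurableSet_pixel n j)
  symm' x y := by
    have : (∃ i j, x ∈ pixel n i ∧ y ∈ pixel n j ∧ G.Adj i j) ↔
        ∃ i j, y ∈ pixel n i ∧ x ∈ pixel n j ∧ G.Adj i j :=
      ⟨fun ⟨i, j, h1, h2, h3⟩ => ⟨j, i, h2, h1, h3.symm⟩,
        fun ⟨i, j, h1, h2, h3⟩ => ⟨j, i, h2, h1, h3.symm⟩⟩
    simp only [this]
  nonneg' x y := by split_ifs <;> norm_num
  le_one' x y := by split_ifs <;> norm_num

open Classical in
/-- The graphon `W^pfx` on `[0,1]²` with the uniform measure. -/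
def prefixGraphon : Graphon (I × I) where
  toFun p q := if (p.1 : ℝ) < q.1 * q.2 ∨ (q.1 : ℝ) < p.1 * p.2 then 1 else 0
  measurable' := by
    refine Measurable.ite ?_ measurable_const measurable_const
    have h1 : Measurable (fun r : (I × I) × (I × I) => ((r.1.1 : I) : ℝ)) := by fun_prop
    have h2 : Measurable (fun r : (I × I) × (I × I) => ((r.1.2 : I) : ℝ)) := by fun_prop
    have h3 : Measurable (fun r : (I × I) × (I × I) => ((r.2.1 : I) : ℝ)) := by fun_prop
    have h4 : Measurable (fun r : (I × I) × (I × I) => ((r.2.2 : I) : ℝ)) := by fun_prop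
    exact (measurableSet_lt h1 (h3.mul h4)).union (measurableSet_lt h3 (h1.mul h2))
  symm' p q := by simp only [or_comm]
  nonneg' p q := by split_ifs <;> norm_num
  le_one' p q := by split_ifs <;> norm_num

/-- The `n`-th prefix attachment graph for the choices `z 1, …, z n`. Its nodes have the labels
`1, …, n` (the label of `i : Fin n` is `i + 1`); the node labelled `m`, when born, is joined
to the older nodes labelled `1, …, z m - 1`. -/
def prefixGraph (z : ℕ → ℕ) (n : ℕ) : SimpleGraph (Fin n) where
  Adj i j := (i < j ∧ (i : ℕ) + 1 < z ((j : ℕ) + 1)) ∨ (j < i ∧ (j : ℕ) + 1 < z ((i : ℕ) + 1))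
  symm := ⟨fun _ _ h => h.symm⟩
  loopless := ⟨fun i h => by simp at h⟩

/-- The random choices of the prefix attachment process: the `z n`, for `n ≥ 1`, are independent
random variables, and `z n` is uniformly distributed on the nodes `1, …, n` present at step `n`.
(The value `z 0` plays no role.) -/
structure IsPrefixChoice {Ω : Type*} [MeasurableSpace Ω] (P : Measure Ω) (z : ℕ → Ω → ℕ) :
    Prop where
  measurable : ∀ n, 1 ≤ n → Measurable (z n)
  indep : iIndepFun (fun n : {n : ℕ // 1 ≤ n} => z n) P
  uniform : ∀ n k, 1 ≤ k → k ≤ n → P.real {ω | z n ω = k} = 1 / (n : ℝ)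

end

/-! ### Isomorphisms of atomless standard probability spaces -/

/-! Place node `m` of the graph on `n` nodes at the point `(m/n, z_m/m)` of the unit square. The
product of its coordinates is `z_m/n`, so `l < z_m` says exactly that `l/n` is less than this
product. Hence adjacency of two nodes is the value of `prefixGraphon` at their points, and only the
distribution of the points is random.

The points equidistribute. For a fixed `K`, the events `z_m/m ≤ b/K` are independent with
probabilities tending to `b/K`; Hoeffding's inequality and Borel–Cantelli give almost sure
convergence of their frequencies (`ae_tendsto_card_filter`). A column of the `K × K` grid is a block
of consecutive nodes, so differences of these prefix counts show that each cell receives a fraction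
`1/K²` of the nodes.

It remains to match `[0,1]` with the square by an invertible measure preserving map. Ordering both
spaces by grid label and applying distribution functions gives a map that preserves labels outside a
set controlled by the discrepancies of the cumulative label counts
(`exists_measurableEquiv_label_ne_le`). Where labels agree, coordinates agree up to `1/K`, so the
two graphons coincide except within `3/K` of the discontinuity of `prefixGraphon`, a set of measure
`O(1/K)`. Letting `n → ∞` and then `K → ∞` gives convergence in edit distance. The cut distance is
smaller, and homomorphism densities are Lipschitz in the edit distance, so the other two senses
follow. -/

open scoped Pointwise in
theorem volume_cantorSet : volume cantorSet = 0 := by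
  have hfin : volume cantorSet ≠ ∞ := isCompact_cantorSet.measure_lt_top.ne
  have h1 : (· / 3) '' cantorSet = (3⁻¹ : ℝ) • cantorSet := by
    ext x
    simp [Set.mem_smul_set, div_eq_inv_mul]
  have h2 : (fun x : ℝ => (2 + x) / 3) '' cantorSet =
      (fun x => 2 / 3 + x) '' ((3⁻¹ : ℝ) • cantorSet) := by
    ext x
    simp only [Set.mem_image, Set.mem_smul_set, smul_eq_mul, exists_exists_and_eq_and]
    refine exists_congr fun y => and_congr_right fun _ => ?_
    rw [show (2 + y) / 3 = 2 / 3 + 3⁻¹ * y by ring]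
  have h3 : volume ((3⁻¹ : ℝ) • cantorSet) = ENNReal.ofReal 3⁻¹ * volume cantorSet := by
    rw [Measure.addHaar_smul]
    simp
  -- Self-similarity: the Cantor set is the union of two copies of itself scaled by `1/3`, so its
  -- measure `v` satisfies `v ≤ 2v/3`.
  have h4 : volume cantorSet ≤ ENNReal.ofReal 3⁻¹ * volume cantorSet +
      ENNReal.ofReal 3⁻¹ * volume cantorSet := by
    conv_lhs => rw [cantorSet_eq_union_halves]
    refine (measure_union_le _ _).trans (add_le_add ?_ ?_)
    · rw [h1, h3]
    · rw [h2, Set.image_add_left, measure_preimage_add, h3]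
  have h5 := ENNReal.toReal_mono (by finiteness) h4
  rw [ENNReal.toReal_add (by finiteness) (by finiteness), ENNReal.toReal_mul,
    ENNReal.toReal_ofReal (by norm_num)] at h5
  have h6 : (volume cantorSet).toReal = 0 :=
    le_antisymm (by linarith) ENNReal.toReal_nonneg
  exact ((ENNReal.toReal_eq_zero_iff _).1 h6).resolve_right hfin

theorem not_countable_cantorSet : ¬ cantorSet.Countable := by
  intro h
  have h1 : Countable (ℕ → Bool) := (Equiv.countable_iff cantorSetEquivNatToBool).1 h.to_subtype
  obtain ⟨f, hf⟩ := exists_surjective_nat (ℕ → Bool)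
  obtain ⟨n, hn⟩ := hf fun n => !(f n n)
  have h2 := congr_fun hn n
  simp at h2

theorem exists_null_not_countable_unitInterval :
    ∃ Z : Set I, MeasurableSet Z ∧ volume Z = 0 ∧ ¬ Z.Countable := by
  refine ⟨Subtype.val ⁻¹' cantorSet, measurable_subtype_coe isClosed_cantorSet.measurableSet, ?_, ?_⟩
  · rw [unitInterval.volume_apply]
    exact measure_mono_null (Set.image_preimage_subset _ _) volume_cantorSet
  · intro h
    refine not_countable_cantorSet ((h.image Subtype.val).mono fun x hx => ?_)
    exact ⟨⟨x, cantorSet_subset_unitInterval hx⟩, hx, rfl⟩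

theorem exists_null_not_countable_unitSquare :
    ∃ Z : Set (I × I), MeasurableSet Z ∧ volume Z = 0 ∧ ¬ Z.Countable := by
  refine ⟨{0} ×ˢ Set.univ, (measurableSet_singleton _).prod .univ, ?_, ?_⟩
  · rw [Measure.volume_eq_prod, Measure.prod_prod]
    simp
  · intro h
    have h1 := h.image Prod.snd
    rw [Set.snd_image_prod (by simp)] at h1
    obtain ⟨Z, -, -, hZ⟩ := exists_null_not_countable_unitInterval
    exact hZ (h1.mono (Set.subset_univ _))

/-- A measure-preserving map that is injective on a conull set agrees almost everywhere with a
measurable equivalence, provided that both spaces have uncountable null sets. -/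
theorem exists_measurableEquiv_ae_eq {X Y : Type*} [MeasurableSpace X] [StandardBorelSpace X]
    [MeasurableSpace Y] [StandardBorelSpace Y] {μ : Measure X} {ν : Measure Y}
    [IsProbabilityMeasure ν]
    (hX : ∃ Z : Set X, MeasurableSet Z ∧ μ Z = 0 ∧ ¬ Z.Countable)
    (hY : ∃ Z : Set Y, MeasurableSet Z ∧ ν Z = 0 ∧ ¬ Z.Countable)
    {F : X → Y} (hF : MeasurePreserving F μ ν) {A : Set X} (hA : MeasurableSet A)
    (hμA : μ Aᶜ = 0) (hinj : Set.InjOn F A) :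
    ∃ φ : X ≃ᵐ Y, MeasurePreserving φ μ ν ∧ ∀ᵐ x ∂μ, φ x = F x := by
  classical
  obtain ⟨Z, hZ, hZ0, hZc⟩ := hX
  obtain ⟨C, hC, hC0, hCc⟩ := hY
  -- Discarding an uncountable null set on each side makes the complements of `B` and of `F '' B`
  -- uncountable standard Borel spaces. These are Borel isomorphic, so `F` on `B` extends to a
  -- bijection; its values on the null set `Bᶜ` do not affect the measure.
  set B : Set X := A \ (Z ∪ F ⁻¹' C) with hB
  have hBm : MeasurableSet B := hA.diff (hZ.union (hF.measurable hC))
  have hB0 : μ Bᶜ = 0 := by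
    have : Bᶜ ⊆ Aᶜ ∪ (Z ∪ F ⁻¹' C) := by
      intro x hx
      by_cases h : x ∈ A
      · right
        by_contra h2
        exact hx ⟨h, h2⟩
      · exact Or.inl h
    refine measure_mono_null this (measure_union_null hμA (measure_union_null hZ0 ?_))
    rw [hF.measure_preimage hC.nullMeasurableSet, hC0]
  have hBinj : Set.InjOn F B := hinj.mono Set.sdiff_subset
  have hFB : MeasurableSet (F '' B) := hBm.image_of_measurable_injOn hF.measurable hBinj
  have := hBm.standardBorel
  have hemb : MeasurableEmbedding (fun x : B => F x) :=
    (hF.measurable.comp measurable_subtype_coe).measurableEmbedding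
      (fun x y h => Subtype.ext (hBinj x.2 y.2 h))
  have hBc : ¬ Countable (Bᶜ : Set X) := fun h =>
    hZc (Set.Countable.mono (show Z ⊆ Bᶜ from fun x hx h => h.2 (Or.inl hx))
      (Set.countable_coe_iff.1 h))
  have hFBc : ¬ Countable ((F '' B)ᶜ : Set Y) := by
    refine fun h => hCc ((Set.countable_coe_iff.1 h).mono ?_)
    rintro _ hy ⟨x, hx, rfl⟩
    exact hx.2 (Or.inr hy)
  have := hBm.compl.standardBorel
  have := hFB.compl.standardBorel
  have hr : F '' B = Set.range (fun x : B => F x) := Set.image_eq_range F B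
  rw [hr] at hFB hFBc this
  let e2 : (Bᶜ : Set X) ≃ᵐ ((Set.range (fun x : B => F x))ᶜ : Set Y) :=
    PolishSpace.measurableEquivOfNotCountable hBc hFBc
  let φ : X ≃ᵐ Y := (MeasurableEquiv.sumCompl hBm).symm.trans
    ((MeasurableEquiv.sumCongr hemb.equivRange e2).trans (MeasurableEquiv.sumCompl hFB))
  have hφ : ∀ x ∈ B, φ x = F x := by
    intro x hx
    have : (MeasurableEquiv.sumCompl hBm).symm x = Sum.inl ⟨x, hx⟩ := by
      rw [MeasurableEquiv.symm_apply_eq]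
      rfl
    simp only [φ, MeasurableEquiv.trans_apply, this]
    change ((hemb.equivRange ⟨x, hx⟩ : Set.range _) : Y) = F x
    rw [hemb.equivRange_apply]
  have hae : ∀ᵐ x ∂μ, φ x = F x := by
    rw [ae_iff]
    exact measure_mono_null (fun x hx h => hx (hφ x h)) hB0
  refine ⟨φ, ⟨φ.measurable, ?_⟩, hae⟩
  rw [Measure.map_congr hae, hF.map_eq]

/-- The distribution function of a probability measure on `ℝ`, as a map to `[0,1]`. -/
noncomputable def cdfI (μ : Measure ℝ) (x : ℝ) : I := ⟨cdf μ x, cdf_nonneg μ x, cdf_le_one μ x⟩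

theorem monotone_cdfI (μ : Measure ℝ) : Monotone (cdfI μ) := fun _ _ h => monotone_cdf μ h

theorem continuous_cdf (μ : Measure ℝ) [IsProbabilityMeasure μ] [NullSingletonClass μ] :
    Continuous (cdf μ) := by
  rw [continuous_iff_continuousAt]
  intro x
  rw [(monotone_cdf μ).continuousAt_iff_leftLim_eq_rightLim, StieltjesFunction.rightLim_eq]
  refine le_antisymm ((monotone_cdf μ).leftLim_le le_rfl) ?_
  have h := StieltjesFunction.measure_singleton (cdf μ) x
  rw [measure_cdf, measure_singleton, eq_comm, ENNReal.ofReal_eq_zero] at h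
  linarith

theorem measurePreserving_cdfI (μ : Measure ℝ) [IsProbabilityMeasure μ] [NullSingletonClass μ] :
    MeasurePreserving (cdfI μ) μ volume := by
  have hm : Measurable (cdfI μ) := (monotone_cdfI μ).measurable
  refine ⟨hm, ?_⟩
  have := Measure.isProbabilityMeasure_map (μ := μ) hm.aemeasurable
  have hex : ∀ s : ℝ, 0 < s → s < 1 → ∃ x, cdf μ x = s := by
    intro s h0 h1
    obtain ⟨a, ha⟩ := ((tendsto_cdf_atBot μ).eventually (gt_mem_nhds h0)).exists
    obtain ⟨b, hb⟩ := ((tendsto_cdf_atTop μ).eventually (lt_mem_nhds h1)).exists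
    exact mem_range_of_exists_le_of_exists_ge (continuous_cdf μ) ⟨a, ha.le⟩ ⟨b, hb.le⟩
  refine Measure.ext_of_Iic _ _ fun t => ?_
  rw [Measure.map_apply hm measurableSet_Iic, unitInterval.volume_Iic]
  refine le_antisymm ?_ ?_
  · rcases eq_or_lt_of_le t.2.2 with h1 | h1
    · rw [h1, ENNReal.ofReal_one]
      exact prob_le_one
    · have key : ∀ s : ℝ, (t : ℝ) < s → s < 1 → μ (cdfI μ ⁻¹' Set.Iic t) ≤ ENNReal.ofReal s := by
        intro s hs hs1
        obtain ⟨y, hy⟩ := hex s (t.2.1.trans_lt hs) hs1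
        rw [← hy, ofReal_cdf]
        refine measure_mono fun x hx => ?_
        by_contra hxy
        have h2 := monotone_cdf μ (not_le.1 hxy).le
        have h3 : cdf μ x ≤ t := hx
        linarith
      have hc : Tendsto (fun s : ℝ => ENNReal.ofReal s) (𝓝[>] (t : ℝ)) (𝓝 (ENNReal.ofReal t)) :=
        (ENNReal.continuous_ofReal.tendsto _).mono_left nhdsWithin_le_nhds
      refine ge_of_tendsto hc ?_
      filter_upwards [Ioo_mem_nhdsGT h1] with s hs using key s hs.1 hs.2
  · rcases eq_or_lt_of_le t.2.1 with h0 | h0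
    · rw [← h0]
      simp
    · rcases eq_or_lt_of_le t.2.2 with h1 | h1
      · have : cdfI μ ⁻¹' Set.Iic t = Set.univ := by
          ext x
          simp only [Set.mem_preimage, Set.mem_Iic, Set.mem_univ, iff_true]
          exact Subtype.coe_le_coe.1 (h1 ▸ cdf_le_one μ x)
        rw [this, measure_univ, h1, ENNReal.ofReal_one]
      · obtain ⟨x, hx⟩ := hex t h0 h1
        rw [← hx, ofReal_cdf]
        refine measure_mono fun y hy => ?_
        have h2 := monotone_cdf μ (show y ≤ x from hy)
        exact Subtype.coe_le_coe.1 (show (cdfI μ y : ℝ) ≤ t from h2.trans hx.le)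

/-- Two points with the same value enclose a rational with that value. Removing the fibres through
the rationals therefore leaves an injective map, and these countably many fibres are null because
the image measure has no atoms. -/
theorem exists_injOn_cdfI (μ : Measure ℝ) [IsProbabilityMeasure μ] [NullSingletonClass μ] :
    ∃ A : Set ℝ, MeasurableSet A ∧ μ Aᶜ = 0 ∧ Set.InjOn (cdfI μ) A := by
  have hp := measurePreserving_cdfI μ
  refine ⟨(⋃ q : ℚ, cdfI μ ⁻¹' {cdfI μ q})ᶜ, ?_, ?_, ?_⟩
  · exact (MeasurableSet.iUnion fun q => hp.measurable (measurableSet_singleton _)).compl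
  · rw [compl_compl, measure_iUnion_null_iff]
    intro q
    rw [hp.measure_preimage (measurableSet_singleton _).nullMeasurableSet, measure_singleton]
  · have key : ∀ x y : ℝ, x ∈ (⋃ q : ℚ, cdfI μ ⁻¹' {cdfI μ q})ᶜ → cdfI μ x = cdfI μ y →
        ¬ x < y := by
      intro x y hx hxy hlt
      obtain ⟨q, hq1, hq2⟩ := exists_rat_btwn hlt
      refine hx (Set.mem_iUnion.2 ⟨q, ?_⟩)
      exact le_antisymm (monotone_cdfI μ hq1.le) ((monotone_cdfI μ hq2.le).trans hxy.symm.le)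
    intro x hx y hy hxy
    exact le_antisymm (not_lt.1 (key y x hy hxy.symm)) (not_lt.1 (key x y hx hxy))

/-- An atomless standard probability space is isomorphic to `[0,1]`, by an isomorphism under
which the level sets of a given `ℕ`-valued function become consecutive intervals. -/
theorem exists_measurableEquiv_unitInterval {X : Type*} [MeasurableSpace X] [StandardBorelSpace X]
    {μ : Measure X} [IsProbabilityMeasure μ] [NullSingletonClass μ]
    (hX : ∃ Z : Set X, MeasurableSet Z ∧ μ Z = 0 ∧ ¬ Z.Countable)
    {f : X → ℕ} (hf : Measurable f) :
    ∃ φ : X ≃ᵐ I, MeasurePreserving φ μ volume ∧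
      ∀ᵐ x ∂μ, μ.real {y | f y < f x} ≤ φ x ∧ (φ x : ℝ) ≤ μ.real {y | f y < f x + 1} := by
  -- The integer part carries the label and the sigmoid, with values in `(0, 1)`, separates points
  -- inside a level set. Thus `e` is injective and orders the level sets of `f` consecutively.
  let e : X → ℝ := fun x => f x + Real.sigmoid (embeddingReal X x)
  have hem : Measurable e := by
    have h1 : Measurable (fun x => (f x : ℝ)) := measurable_from_nat.comp hf
    exact h1.add (_root_.continuous_sigmoid.measurable.comp (measurable_embeddingReal X))
  have hlt : ∀ x y, f x < f y → e x < e y := by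
    intro x y h
    have h1 : (f x : ℝ) + 1 ≤ f y := by exact_mod_cast h
    have h2 := Real.sigmoid_lt_one (embeddingReal X x)
    have h3 := Real.sigmoid_pos (embeddingReal X y)
    simp only [e]
    linarith
  have hinj : Function.Injective e := by
    intro x y h
    have h1 : f x = f y := by
      rcases lt_trichotomy (f x) (f y) with h1 | h1 | h1
      · exact absurd h (hlt _ _ h1).ne
      · exact h1
      · exact absurd h (hlt _ _ h1).ne'
    simp only [e, h1, add_right_inj, Real.sigmoid_inj] at h
    exact (measurableEmbedding_embeddingReal X).injective h
  have := Measure.isProbabilityMeasure_map (μ := μ) hem.aemeasurable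
  have : NullSingletonClass (μ.map e) := by
    refine ⟨fun t => ?_⟩
    rw [Measure.map_apply hem (measurableSet_singleton t)]
    exact (Set.subsingleton_singleton.preimage hinj).measure_zero μ
  obtain ⟨A, hA, hA0, hAinj⟩ := exists_injOn_cdfI (μ.map e)
  have hF : MeasurePreserving (cdfI (μ.map e) ∘ e) μ volume :=
    (measurePreserving_cdfI _).comp (hem.measurePreserving μ)
  obtain ⟨φ, hφ, hae⟩ := exists_measurableEquiv_ae_eq hX exists_null_not_countable_unitInterval hF
    (hem hA) (by rw [← Set.preimage_compl, ← Measure.map_apply hem hA.compl, hA0])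
    (fun x hx y hy h => hinj (hAinj hx hy h))
  refine ⟨φ, hφ, ?_⟩
  filter_upwards [hae] with x hx
  have h1 : (φ x : ℝ) = μ.real {y | e y ≤ e x} := by
    rw [hx]
    change cdf (μ.map e) (e x) = _
    rw [cdf_eq_real, Measure.real, Measure.real, Measure.map_apply hem measurableSet_Iic]
    rfl
  rw [h1]
  refine ⟨measureReal_mono fun y hy => (hlt y x hy).le, measureReal_mono fun y hy => ?_⟩
  by_contra h2
  have h3 : f x < f y := by
    have : ¬ f y < f x + 1 := h2
    omega
  exact absurd (hlt x y h3) (not_lt.2 hy)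

theorem volume_coe_mem_uIcc_le (a b : ℝ) :
    volume {s : I | (s : ℝ) ∈ Set.uIcc a b} ≤ ENNReal.ofReal |a - b| := by
  rw [unitInterval.volume_apply]
  refine (measure_mono (t := Set.uIcc a b) ?_).trans ?_
  · rintro _ ⟨s, hs, rfl⟩
    exact hs
  · rw [Real.volume_interval, abs_sub_comm]

/-- Two labelled atomless standard probability spaces are isomorphic, by an isomorphism that
preserves the labels up to the difference of their distributions. -/
theorem exists_measurableEquiv_label_ne_le {X Y : Type*} [MeasurableSpace X]
    [StandardBorelSpace X] [MeasurableSpace Y] [StandardBorelSpace Y] {μ : Measure X}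
    {ν : Measure Y} [IsProbabilityMeasure μ] [IsProbabilityMeasure ν] [NullSingletonClass μ]
    [NullSingletonClass ν]
    (hX : ∃ Z : Set X, MeasurableSet Z ∧ μ Z = 0 ∧ ¬ Z.Countable)
    (hY : ∃ Z : Set Y, MeasurableSet Z ∧ ν Z = 0 ∧ ¬ Z.Countable)
    {g : X → ℕ} (hg : Measurable g) {f : Y → ℕ} (hf : Measurable f) {N : ℕ} (hN : ∀ x, g x < N) :
    ∃ φ : X ≃ᵐ Y, MeasurePreserving φ μ ν ∧ μ {x | g x ≠ f (φ x)} ≤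
      ∑ c ∈ Finset.range (N + 1), ENNReal.ofReal |μ.real {x | g x < c} - ν.real {y | f y < c}| := by
  obtain ⟨φ, hφ, hφg⟩ := exists_measurableEquiv_unitInterval hX hg
  obtain ⟨ψ, hψ, hψf⟩ := exists_measurableEquiv_unitInterval hY hf
  have hψ' : MeasurePreserving ψ.symm volume ν := hψ.symm ψ
  refine ⟨φ.trans ψ.symm, hψ'.comp hφ, ?_⟩
  have hψf' := (hψ'.comp hφ).quasiMeasurePreserving.ae hψf
  set S : Set I := ⋃ c ∈ Finset.range (N + 1),
    {s : I | (s : ℝ) ∈ Set.uIcc (μ.real {x | g x < c}) (ν.real {y | f y < c})} with hS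
  have hsub : ∀ᵐ x ∂μ, x ∈ {x | g x ≠ f ((φ.trans ψ.symm) x)} →
      x ∈ φ ⁻¹' S := by
    filter_upwards [hφg, hψf'] with x h1 h2 h3
    simp only [Function.comp_apply, MeasurableEquiv.apply_symm_apply] at h2
    simp only [hS, Set.mem_preimage, Set.mem_iUnion, exists_prop, Finset.mem_range]
    set y := ψ.symm (φ x) with hy
    have h3 : g x ≠ f y := h3
    -- If the labels differ, some cut `c` separates them: `c = g x + 1` when `g x < f y`, and `c = g
    -- x` otherwise. The common image in `[0,1]` then lies between the two distribution functions at
    -- `c`, and `c ≤ N` in both cases.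
    rcases lt_or_gt_of_ne h3 with h | h
    · refine ⟨g x + 1, Nat.succ_lt_succ (hN x), ?_⟩
      refine Set.mem_uIcc.2 (Or.inr ⟨le_trans (measureReal_mono fun z hz => ?_) h2.1, h1.2⟩)
      exact lt_of_lt_of_le (Set.mem_ofPred.1 hz) (Nat.le_of_lt_succ (Nat.succ_lt_succ h))
    · refine ⟨g x, Nat.lt_succ_of_lt (hN x), ?_⟩
      refine Set.mem_uIcc.2 (Or.inl ⟨h1.1, h2.2.trans (measureReal_mono fun z hz => ?_)⟩)
      exact lt_of_lt_of_le (Set.mem_ofPred.1 hz) (Nat.succ_le_of_lt h)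
  refine (measure_mono_ae (t := φ ⁻¹' S) hsub).trans ?_
  rw [hφ.measure_preimage_equiv]
  refine (measure_biUnion_finset_le _ _).trans (Finset.sum_le_sum fun c _ => ?_)
  exact volume_coe_mem_uIcc_le _ _

/-! ### Cut distance, edit distance and homomorphism densities -/

theorem cutDist_le_editDist {α β : Type*} [MeasureSpace α] [MeasureSpace β] (U : Graphon α)
    (W : Graphon β) : cutDist U W ≤ editDist U W := by
  refine iInf_mono fun φ => iInf_mono fun _ => ?_
  refine iSup_le fun S => iSup_le fun T => iSup_le fun _ => iSup_le fun _ => ?_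
  calc _ ≤ ENNReal.ofReal (∫ p in S ×ˢ T, |U.toFun p.1 p.2 - W.toFun (φ p.1) (φ p.2)|) :=
        ENNReal.ofReal_le_ofReal abs_integral_le_integral_abs
    _ ≤ ∫⁻ p in S ×ˢ T, ENNReal.ofReal |U.toFun p.1 p.2 - W.toFun (φ p.1) (φ p.2)| := by
        refine ENNReal.ofReal_le_of_le_toReal ?_
        rw [integral_eq_lintegral_of_nonneg_ae (Eventually.of_forall fun _ => abs_nonneg _)]
        have h1 := U.measurable'
        have h2 := W.measurable'.comp (φ.measurable.prodMap φ.measurable)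
        exact (h1.sub h2).norm.aestronglyMeasurable
    _ ≤ _ := setLIntegral_le_lintegral _ _

/-- The pull-back `W^φ` of a graphon. -/
def Graphon.comap {α β : Type*} [MeasurableSpace α] [MeasurableSpace β] (W : Graphon β)
    (φ : α → β) (hφ : Measurable φ) : Graphon α where
  toFun x y := W.toFun (φ x) (φ y)
  measurable' := W.measurable'.comp (hφ.prodMap hφ)
  symm' _ _ := W.symm' _ _
  nonneg' _ _ := W.nonneg' _ _
  le_one' _ _ := W.le_one' _ _

/-- The value of a graphon at the (unordered) pair of points that `x` assigns to the pair `e`. -/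
def Graphon.edgeValue {α : Type*} [MeasurableSpace α] (W : Graphon α) {k : ℕ} (x : Fin k → α)
    (e : Sym2 (Fin k)) : ℝ :=
  Sym2.lift ⟨fun i j => W.toFun (x i) (x j), fun i j => W.symm' (x i) (x j)⟩ e

theorem Graphon.edgeValue_mem {α : Type*} [MeasurableSpace α] (W : Graphon α) {k : ℕ}
    (x : Fin k → α) (e : Sym2 (Fin k)) : W.edgeValue x e ∈ Set.Icc (0 : ℝ) 1 := by
  induction e with
  | _ i j => exact ⟨W.nonneg' _ _, W.le_one' _ _⟩

theorem Graphon.measurable_edgeValue {α : Type*} [MeasurableSpace α] (W : Graphon α) {k : ℕ}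
    (e : Sym2 (Fin k)) : Measurable fun x : Fin k → α => W.edgeValue x e := by
  induction e with
  | _ i j =>
    exact W.measurable'.comp (f := fun x : Fin k → α => (x i, x j))
      ((measurable_pi_apply i).prodMk (measurable_pi_apply j))

theorem Graphon.integrable_prod_edgeValue {α : Type*} [MeasureSpace α]
    [IsProbabilityMeasure (volume : Measure α)] (W : Graphon α) {k : ℕ}
    (s : Finset (Sym2 (Fin k))) : Integrable fun x : Fin k → α => ∏ e ∈ s, W.edgeValue x e := by
  refine Integrable.of_mem_Icc 0 1 ?_ (Eventually.of_forall fun x => ?_)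
  · exact (Finset.measurable_fun_prod s fun e _ => W.measurable_edgeValue e).aemeasurable
  · exact ⟨Finset.prod_nonneg fun e _ => (W.edgeValue_mem x e).1,
      Finset.prod_le_one (fun e _ => (W.edgeValue_mem x e).1) fun e _ => (W.edgeValue_mem x e).2⟩

open Classical in
theorem graphonDensity_eq_integral {k : ℕ} {α : Type*} [MeasureSpace α]
    (F : SimpleGraph (Fin k)) (W : Graphon α) :
    graphonDensity F W = ∫ x : Fin k → α, ∏ e ∈ F.edgeFinset, W.edgeValue x e :=
  rfl

theorem graphonDensity_comap {k : ℕ} {α β : Type*} [MeasureSpace α] [MeasureSpace β]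
    [IsProbabilityMeasure (volume : Measure α)] [IsProbabilityMeasure (volume : Measure β)]
    (F : SimpleGraph (Fin k)) (W : Graphon β) (φ : α ≃ᵐ β) (hφ : MeasurePreserving φ) :
    graphonDensity F (W.comap φ φ.measurable) = graphonDensity F W := by
  classical
  have h : MeasurePreserving (MeasurableEquiv.piCongrRight fun _ : Fin k => φ)
      (volume : Measure (Fin k → α)) (volume : Measure (Fin k → β)) :=
    volume_preserving_pi fun _ => hφ
  rw [graphonDensity_eq_integral, graphonDensity_eq_integral,
    ← h.integral_comp (MeasurableEquiv.measurableEmbedding _)]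
  refine integral_congr_ae (Eventually.of_forall fun x => Finset.prod_congr rfl fun e _ => ?_)
  induction e with
  | _ i j => rfl

/-! ### The counting lemma in the edit distance -/

theorem abs_prod_sub_prod_le {ι : Type*} (s : Finset ι) (a b : ι → ℝ)
    (ha : ∀ i ∈ s, a i ∈ Set.Icc (0 : ℝ) 1) (hb : ∀ i ∈ s, b i ∈ Set.Icc (0 : ℝ) 1) :
    |∏ i ∈ s, a i - ∏ i ∈ s, b i| ≤ ∑ i ∈ s, |a i - b i| := by
  classical
  induction s using Finset.induction_on with
  | empty => simp
  | insert i s hi ih =>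
    rw [Finset.prod_insert hi, Finset.prod_insert hi, Finset.sum_insert hi]
    have ih' := ih (fun j hj => ha j (Finset.mem_insert_of_mem hj))
      (fun j hj => hb j (Finset.mem_insert_of_mem hj))
    have hai := ha i (Finset.mem_insert_self _ _)
    have hP0 : 0 ≤ ∏ j ∈ s, b j :=
      Finset.prod_nonneg fun j hj => (hb j (Finset.mem_insert_of_mem hj)).1
    have hP1 : ∏ j ∈ s, b j ≤ 1 :=
      Finset.prod_le_one (fun j hj => (hb j (Finset.mem_insert_of_mem hj)).1)
        fun j hj => (hb j (Finset.mem_insert_of_mem hj)).2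
    calc _ = |a i * (∏ j ∈ s, a j - ∏ j ∈ s, b j) + (a i - b i) * ∏ j ∈ s, b j| := by ring_nf
      _ ≤ |a i * (∏ j ∈ s, a j - ∏ j ∈ s, b j)| + |(a i - b i) * ∏ j ∈ s, b j| := abs_add_le _ _
      _ ≤ |∏ j ∈ s, a j - ∏ j ∈ s, b j| + |a i - b i| := by
        rw [abs_mul, abs_mul, abs_of_nonneg hai.1, abs_of_nonneg hP0]
        exact add_le_add (mul_le_of_le_one_left (abs_nonneg _) hai.2)
          (mul_le_of_le_one_right (abs_nonneg _) hP1)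
      _ ≤ _ := by linarith

theorem measurePreserving_eval_pair {α : Type*} [MeasureSpace α]
    [IsProbabilityMeasure (volume : Measure α)] {k : ℕ} {i j : Fin k} (hij : i ≠ j) :
    MeasurePreserving (fun x : Fin k → α => (x i, x j)) := by
  have hi := (iIndepFun_pi (μ := fun _ : Fin k => (volume : Measure α)) (X := fun _ => id)
    fun _ => aemeasurable_id).indepFun hij
  simp only [id] at hi
  rw [indepFun_iff_map_prod_eq_prod_map_map (measurable_pi_apply i).aemeasurable
    (measurable_pi_apply j).aemeasurable] at hi
  refine ⟨(measurable_pi_apply i).prodMk (measurable_pi_apply j), ?_⟩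
  have h (l : Fin k) := (measurePreserving_eval (fun _ : Fin k => (volume : Measure α)) l).map_eq
  have hi' : Measure.map (fun x : Fin k → α => (x i, x j)) (Measure.pi fun _ => volume) =
    (Measure.map (Function.eval i) (Measure.pi fun _ : Fin k => (volume : Measure α))).prod
      (Measure.map (Function.eval j) (Measure.pi fun _ : Fin k => (volume : Measure α))) := hi
  rw [h, h] at hi'
  exact hi'

open Classical in
/-- The counting lemma for the `L¹` norm. -/
theorem ofReal_abs_graphonDensity_sub_le {k : ℕ} {α : Type*} [MeasureSpace α]
    [IsProbabilityMeasure (volume : Measure α)] (F : SimpleGraph (Fin k)) (U W : Graphon α) :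
    ENNReal.ofReal |graphonDensity F U - graphonDensity F W| ≤
      (F.edgeFinset.card : ℝ≥0∞) * oneNorm (fun x y => U.toFun x y - W.toFun x y) := by
  rw [graphonDensity_eq_integral, graphonDensity_eq_integral,
    ← integral_sub (U.integrable_prod_edgeValue _) (W.integrable_prod_edgeValue _),
    ← Real.enorm_eq_ofReal_abs]
  refine (enorm_integral_le_lintegral_enorm _).trans ?_
  calc _ ≤ ∫⁻ x : Fin k → α, ∑ e ∈ F.edgeFinset,
        ENNReal.ofReal |U.edgeValue x e - W.edgeValue x e| := by
        refine lintegral_mono fun x => ?_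
        rw [Real.enorm_eq_ofReal_abs, ← ENNReal.ofReal_sum_of_nonneg fun _ _ => abs_nonneg _]
        exact ENNReal.ofReal_le_ofReal (abs_prod_sub_prod_le _ _ _
          (fun e _ => U.edgeValue_mem x e) fun e _ => W.edgeValue_mem x e)
    _ = ∑ e ∈ F.edgeFinset, ∫⁻ x : Fin k → α,
        ENNReal.ofReal |U.edgeValue x e - W.edgeValue x e| :=
        lintegral_finsetSum _ fun e _ =>
          ((U.measurable_edgeValue e).sub (W.measurable_edgeValue e)).norm.ennreal_ofReal
    _ = ∑ e ∈ F.edgeFinset, oneNorm (fun x y => U.toFun x y - W.toFun x y) := by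
        refine Finset.sum_congr rfl fun e he => ?_
        induction e with
        | _ i j =>
          -- `F` has no loops, so the two coordinates are independent and the integral for one edge
          -- is the full `L¹` norm.
          have hij : i ≠ j := by
            rw [SimpleGraph.mem_edgeFinset, SimpleGraph.mem_edgeSet] at he
            exact he.ne
          exact (measurePreserving_eval_pair (α := α) hij).lintegral_comp
            (f := fun p => ENNReal.ofReal |U.toFun p.1 p.2 - W.toFun p.1 p.2|)
            (U.measurable'.sub W.measurable').norm.ennreal_ofReal
    _ = _ := by rw [Finset.sum_const, nsmul_eq_mul]

open Classical in
theorem ofReal_abs_graphonDensity_sub_le_editDist {k : ℕ} {α β : Type*} [MeasureSpace α]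
    [MeasureSpace β] [IsProbabilityMeasure (volume : Measure α)]
    [IsProbabilityMeasure (volume : Measure β)] (F : SimpleGraph (Fin k)) (U : Graphon α)
    (W : Graphon β) :
    ENNReal.ofReal |graphonDensity F U - graphonDensity F W| ≤
      (F.edgeFinset.card : ℝ≥0∞) * editDist U W := by
  -- Moving the constant inside the infimum requires it to be nonzero; without edges both densities
  -- are integrals of the empty product.
  rcases eq_or_ne F.edgeFinset.card 0 with h0 | h0
  · simp [graphonDensity_eq_integral, Finset.card_eq_zero.1 h0]
  have h1 : (F.edgeFinset.card : ℝ≥0∞) ≠ 0 := Nat.cast_ne_zero.2 h0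
  simp only [editDist, ENNReal.mul_iInf_of_ne h1 (ENNReal.natCast_ne_top _)]
  refine le_iInf₂ fun φ hφ => ?_
  rw [← graphonDensity_comap F W φ hφ]
  exact ofReal_abs_graphonDensity_sub_le F U _

/-- The index of the interval that contains a given point of `[0,1]`. -/
noncomputable def pixelIndex (n : ℕ) [NeZero n] (x : I) : Fin n :=
  ⟨min ⌊(n : ℝ) * (x : ℝ)⌋₊ (n - 1), by have := NeZero.pos n; omega⟩

theorem mem_pixel_iff {n : ℕ} [NeZero n] {x : I} {i : Fin n} :
    x ∈ pixel n i ↔ pixelIndex n x = i := by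
  rw [Fin.ext_iff]
  rfl

theorem measurable_pixelIndex (n : ℕ) [NeZero n] : Measurable (pixelIndex n) := by
  refine measurable_to_countable' fun i => ?_
  have : pixelIndex n ⁻¹' {i} = pixel n i := by
    ext x
    simp [mem_pixel_iff]
  rw [this]
  exact measurableSet_pixel n i

theorem pixelIndex_le_mul {n : ℕ} [NeZero n] (x : I) : ((pixelIndex n x : ℕ) : ℝ) ≤ n * x := by
  have h1 : ((pixelIndex n x : ℕ) : ℝ) ≤ ⌊(n : ℝ) * (x : ℝ)⌋₊ := by
    exact_mod_cast min_le_left _ _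
  exact h1.trans (Nat.floor_le (mul_nonneg (Nat.cast_nonneg _) x.2.1))

theorem mul_le_pixelIndex_add_one {n : ℕ} [NeZero n] (x : I) :
    (n : ℝ) * x ≤ (pixelIndex n x : ℕ) + 1 := by
  rcases le_total ⌊(n : ℝ) * (x : ℝ)⌋₊ (n - 1) with h | h
  · have : ((pixelIndex n x : ℕ)) = ⌊(n : ℝ) * (x : ℝ)⌋₊ := min_eq_left h
    rw [this]
    exact (Nat.lt_floor_add_one _).le
  · have h1 : ((pixelIndex n x : ℕ)) = n - 1 := min_eq_right h
    have h2 : (pixelIndex n x : ℕ) + 1 = n := by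
      have := NeZero.pos n
      omega
    have h3 : ((pixelIndex n x : ℕ) : ℝ) + 1 = n := by exact_mod_cast h2
    rw [h3]
    exact mul_le_of_le_one_right (Nat.cast_nonneg _) x.2.2

/-- The last interval is closed on the right and the others are not, so each is squeezed between a
half-open and a closed interval of length `1/n`. -/
theorem volume_real_pixelIndex_preimage {n : ℕ} [NeZero n] (i : Fin n) :
    volume.real (pixelIndex n ⁻¹' {i}) = 1 / n := by
  have hn : (0 : ℝ) < n := by exact_mod_cast NeZero.pos n
  have hi : ((i : ℕ) : ℝ) + 1 ≤ n := by exact_mod_cast i.2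
  let a : I := ⟨i / n, by positivity, (div_le_one hn).2 (by linarith)⟩
  let b : I := ⟨(i + 1) / n, by positivity, (div_le_one hn).2 hi⟩
  have hsub : Set.Ico a b ⊆ pixelIndex n ⁻¹' {i} := by
    intro x hx
    have h1 : (i : ℝ) / n ≤ x := hx.1
    have h2 : (x : ℝ) < (i + 1) / n := hx.2
    rw [div_le_iff₀ hn] at h1
    rw [lt_div_iff₀ hn] at h2
    have h3 : ⌊(n : ℝ) * (x : ℝ)⌋₊ = i := by
      rw [Nat.floor_eq_iff (mul_nonneg hn.le x.2.1)]
      constructor <;> linarith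
    rw [Set.mem_preimage, Set.mem_singleton_iff, ← mem_pixel_iff]
    change min _ _ = _
    rw [h3]
    have := i.2
    omega
  have hsup : pixelIndex n ⁻¹' {i} ⊆ Set.Icc a b := by
    intro x hx
    have h1 := pixelIndex_le_mul (n := n) x
    have h2 := mul_le_pixelIndex_add_one (n := n) x
    rw [Set.mem_preimage, Set.mem_singleton_iff] at hx
    rw [hx] at h1 h2
    constructor
    · change (i : ℝ) / n ≤ x
      rw [div_le_iff₀ hn]
      linarith
    · change (x : ℝ) ≤ (i + 1) / n
      rw [le_div_iff₀ hn]
      linarith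
  have h : volume (pixelIndex n ⁻¹' {i}) = ENNReal.ofReal (b - a) :=
    le_antisymm ((measure_mono hsup).trans_eq (unitInterval.volume_Icc a b))
      ((unitInterval.volume_Ico a b).symm.trans_le (measure_mono hsub))
  rw [Measure.real, h]
  have hba : (b : ℝ) - a = 1 / n := by
    change ((i : ℝ) + 1) / n - i / n = 1 / n
    ring
  rw [hba, ENNReal.toReal_ofReal (by positivity)]

theorem graphGraphon_apply {n : ℕ} [NeZero n] (G : SimpleGraph (Fin n)) (x y : I)
    [Decidable (G.Adj (pixelIndex n x) (pixelIndex n y))] :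
    (graphGraphon G).toFun x y = if G.Adj (pixelIndex n x) (pixelIndex n y) then 1 else 0 := by
  have : (∃ i j, x ∈ pixel n i ∧ y ∈ pixel n j ∧ G.Adj i j) ↔
      G.Adj (pixelIndex n x) (pixelIndex n y) := by
    simp [mem_pixel_iff]
  simp only [graphGraphon, this]

/-- The homomorphism densities of a graph and of its graphon agree. -/
theorem graphonDensity_graphGraphon {k n : ℕ} [NeZero n] (F : SimpleGraph (Fin k))
    (G : SimpleGraph (Fin n)) : graphonDensity F (graphGraphon G) = homDensity F G := by
  classical
  -- Passing to interval indices turns the integral into one against the uniform measure on maps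
  -- `Fin k → Fin n`, with the indicator of being a homomorphism as integrand.
  set ν : Measure (Fin n) := Measure.map (pixelIndex n) volume with hν
  have : IsProbabilityMeasure ν :=
    Measure.isProbabilityMeasure_map (measurable_pixelIndex n).aemeasurable
  have hmp : MeasurePreserving (fun (x : Fin k → I) a => pixelIndex n (x a))
      volume (Measure.pi fun _ => ν) :=
    measurePreserving_pi _ _ fun _ => (measurable_pixelIndex n).measurePreserving volume
  have hν1 : ∀ i, ν.real {i} = 1 / n := by
    intro i
    rw [hν, map_measureReal_apply (measurable_pixelIndex n) (measurableSet_singleton i),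
      volume_real_pixelIndex_preimage]
  have hH : ∀ x : Fin k → I, ∏ e ∈ F.edgeFinset, (graphGraphon G).edgeValue x e =
      if ∀ a b, F.Adj a b → G.Adj (pixelIndex n (x a)) (pixelIndex n (x b)) then 1 else 0 := by
    intro x
    split_ifs with h
    · refine Finset.prod_eq_one fun e he => ?_
      induction e with
      | _ a b =>
        rw [SimpleGraph.mem_edgeFinset, SimpleGraph.mem_edgeSet] at he
        exact (graphGraphon_apply G _ _).trans (if_pos (h a b he))
    · push Not at h
      obtain ⟨a, b, hab, hG⟩ := h
      refine Finset.prod_eq_zero (i := s(a, b)) ?_ ?_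
      · rwa [SimpleGraph.mem_edgeFinset, SimpleGraph.mem_edgeSet]
      · exact (graphGraphon_apply G _ _).trans (if_neg hG)
  rw [graphonDensity_eq_integral]
  simp only [hH]
  have h1 := hmp.map_eq ▸ integral_map (μ := (volume : Measure (Fin k → I)))
    hmp.measurable.aemeasurable (f := fun v : Fin k → Fin n =>
      (if ∀ a b, F.Adj a b → G.Adj (v a) (v b) then (1 : ℝ) else 0))
    (measurable_of_finite _).aestronglyMeasurable
  rw [← h1, integral_fintype (Integrable.of_finite)]
  have h2 : ∀ v : Fin k → Fin n, (Measure.pi fun _ : Fin k => ν).real {v} = 1 / (n : ℝ) ^ k := by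
    intro v
    rw [measureReal_def, Measure.pi_singleton, ENNReal.toReal_prod]
    simp only [← measureReal_def, hν1]
    simp
  simp only [h2, smul_eq_mul, ← Finset.mul_sum, Finset.sum_boole]
  have h3 : Nat.card (F →g G) =
      (Finset.univ.filter fun v : Fin k → Fin n => ∀ a b, F.Adj a b → G.Adj (v a) (v b)).card := by
    rw [← Fintype.card_subtype, ← Nat.card_eq_fintype_card]
    exact Nat.card_congr
      { toFun := fun f => ⟨f, fun a b h => f.map_adj h⟩
        invFun := fun v => ⟨v.1, fun {a b} h => v.2 a b h⟩
        left_inv := fun _ => rfl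
        right_inv := fun _ => rfl }
  rw [homDensity, h3]
  ring

/-! ### Comparing prefix attachment graphs with the limit graphon -/

/-- The label (in `0, …, K * K - 1`) of the cell of the `K × K` grid that contains a point. -/
noncomputable def gridLabel (K : ℕ) [NeZero K] (p : I × I) : ℕ :=
  pixelIndex K p.1 * K + pixelIndex K p.2

/-- The grid label of the point `((i + 1) / n, z (i + 1) / (i + 1))`. -/
def nodeLabel (K : ℕ) (z : ℕ → ℕ) (n i : ℕ) : ℕ :=
  ((i + 1) * K - 1) / n * K + (z (i + 1) * K - 1) / (i + 1)

theorem measurable_gridLabel (K : ℕ) [NeZero K] : Measurable (gridLabel K) := by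
  have h1 : Measurable fun p : I × I => ((pixelIndex K p.1 : Fin K) : ℕ) :=
    (measurable_of_finite _).comp ((measurable_pixelIndex K).comp measurable_fst)
  have h2 : Measurable fun p : I × I => ((pixelIndex K p.2 : Fin K) : ℕ) :=
    (measurable_of_finite _).comp ((measurable_pixelIndex K).comp measurable_snd)
  exact (h1.mul_const K).add h2

/-- The points `(p, q)` at which `p.1` is within `δ` of the threshold `q.1 * q.2`. -/
def nearThreshold (δ : ℝ) : Set ((I × I) × (I × I)) :=
  {r | |(r.1.1 : ℝ) - r.2.1 * r.2.2| ≤ δ}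

theorem measurableSet_nearThreshold (δ : ℝ) : MeasurableSet (nearThreshold δ) := by
  have h : Measurable fun r : (I × I) × (I × I) => |(r.1.1 : ℝ) - r.2.1 * r.2.2| := by fun_prop
  exact measurableSet_le h measurable_const

/-- For fixed `q` the first coordinate of `p` is confined to an interval of length `2 * δ`, and
Fubini applies. -/
theorem volume_nearThreshold_le (δ : ℝ) :
    volume (nearThreshold δ) ≤ ENNReal.ofReal (2 * δ) := by
  rw [Measure.volume_eq_prod, Measure.prod_apply_symm (measurableSet_nearThreshold δ)]
  calc _ ≤ ∫⁻ _ : I × I, ENNReal.ofReal (2 * δ) := by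
        refine lintegral_mono fun q => ?_
        set c : ℝ := q.1 * q.2
        have h1 : (fun p : I × I => (p, q)) ⁻¹' nearThreshold δ =
            {x : I | |(x : ℝ) - c| ≤ δ} ×ˢ Set.univ := by
          ext p
          simp [nearThreshold, c]
        rw [h1, Measure.volume_eq_prod, Measure.prod_prod, measure_univ, mul_one,
          unitInterval.volume_apply]
        refine (measure_mono (t := Set.Icc (c - δ) (c + δ)) ?_).trans ?_
        · rintro _ ⟨x, hx, rfl⟩
          have hx' : |(x : ℝ) - c| ≤ δ := hx
          rw [abs_le] at hx'
          constructor <;> linarith [hx'.1, hx'.2]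
        · rw [Real.volume_Icc]
          exact ENNReal.ofReal_le_ofReal (by linarith)
    _ = _ := by simp

theorem mul_add_eq_mul_add_iff {K a b a' b' : ℕ} (hb : b < K) (hb' : b' < K) :
    a * K + b = a' * K + b' ↔ a = a' ∧ b = b' := by
  refine ⟨fun h => ?_, fun ⟨h1, h2⟩ => by rw [h1, h2]⟩
  have hK : 0 < K := by omega
  have h1 := congrArg (· / K) h
  have h2 := congrArg (· % K) h
  simp only [Nat.mul_add_mod', Nat.mod_eq_of_lt hb, Nat.mod_eq_of_lt hb'] at h2
  simp only [Nat.add_comm (_ * K), Nat.add_mul_div_right _ _ hK, Nat.div_eq_of_lt hb,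
    Nat.div_eq_of_lt hb', Nat.zero_add] at h1
  exact ⟨h1, h2⟩

theorem pred_div_lt {K m j : ℕ} (hK : 0 < K) (hj : 1 ≤ j) (hjm : j ≤ m) :
    (j * K - 1) / m < K := by
  rw [Nat.div_lt_iff_lt_mul (by omega), mul_comm K]
  have h1 : j * K ≤ m * K := Nat.mul_le_mul_right K hjm
  have h2 : 0 < j * K := Nat.mul_pos hj hK
  omega

/-- `(j * K - 1) / m` is `⌈jK/m⌉ - 1`: here cells are closed on the right, so that the ratio `1`
falls in the last one, while `pixelIndex` closes them on the left. Both points still lie in the same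
closed interval of length `1/K`. -/
theorem near_of_pred_div_eq {K m j : ℕ} [NeZero K] {x : I} (hj : 1 ≤ j) (hm : 0 < m)
    (hx : (j * K - 1) / m = (pixelIndex K x : ℕ)) : |(j : ℝ) / m - x| ≤ 1 / K := by
  have hK : 0 < K := NeZero.pos K
  have h1 := pixelIndex_le_mul (n := K) x
  have h2 := mul_le_pixelIndex_add_one (n := K) x
  set a : ℕ := (pixelIndex K x).val
  rw [Nat.div_eq_iff hm] at hx
  have h3 : a * m ≤ j * K := by omega
  have h4 : j * K ≤ (a + 1) * m := by
    have := Nat.mul_pos hj hK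
    rw [add_mul, one_mul]
    omega
  have hm' : (0 : ℝ) < m := by exact_mod_cast hm
  have hK' : (0 : ℝ) < K := by exact_mod_cast hK
  have h5 : (a : ℝ) / K ≤ j / m := by
    rw [div_le_div_iff₀ hK' hm']
    exact_mod_cast h3
  have h6 : (j : ℝ) / m ≤ (a + 1) / K := by
    rw [div_le_div_iff₀ hm' hK']
    exact_mod_cast h4
  have h7 : (a : ℝ) / K ≤ x := by
    rw [div_le_iff₀ hK']
    linarith
  have h8 : (x : ℝ) ≤ (a + 1) / K := by
    rw [le_div_iff₀ hK']
    linarith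
  rw [add_div] at h6 h8
  rw [abs_le]
  constructor <;> linarith

theorem near_of_nodeLabel_eq {K n i : ℕ} [NeZero K] {z : ℕ → ℕ} (hi : i < n)
    (hz : 1 ≤ z (i + 1)) (hz' : z (i + 1) ≤ i + 1) {q : I × I}
    (h : nodeLabel K z n i = gridLabel K q) :
    |((i : ℝ) + 1) / n - q.1| ≤ 1 / K ∧ |(z (i + 1) : ℝ) / (i + 1) - q.2| ≤ 1 / K := by
  obtain ⟨h1, h2⟩ := (mul_add_eq_mul_add_iff
    (pred_div_lt (NeZero.pos K) hz hz') (pixelIndex K q.2).2).1 h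
  have h3 := near_of_pred_div_eq (by omega) (by omega) h1
  have h4 := near_of_pred_div_eq hz (by omega) h2
  push_cast at h3 h4
  exact ⟨h3, h4⟩

/-- The left side moves by at most `ε` and the product of numbers in `[0,1]` by at most `2ε`, hence
the margin `3ε`. -/
theorem lt_mul_iff_of_near {u v w u' v' w' ε : ℝ} (hu : |u - u'| ≤ ε) (hv : |v - v'| ≤ ε)
    (hw : |w - w'| ≤ ε) (hw0 : 0 ≤ w) (hw1 : w ≤ 1) (hv0 : 0 ≤ v') (hv1 : v' ≤ 1)
    (h : 3 * ε < |u' - v' * w'|) : u < v * w ↔ u' < v' * w' := by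
  have h1 : |v * w - v' * w'| ≤ 2 * ε := by
    calc |v * w - v' * w'| = |(v - v') * w + v' * (w - w')| := by ring_nf
      _ ≤ |v - v'| * w + v' * |w - w'| := by
        refine (abs_add_le _ _).trans ?_
        rw [abs_mul, abs_mul, abs_of_nonneg hw0, abs_of_nonneg hv0]
      _ ≤ |v - v'| + |w - w'| := add_le_add (mul_le_of_le_one_right (abs_nonneg _) hw1)
        (mul_le_of_le_one_left (abs_nonneg _) hv1)
      _ ≤ 2 * ε := by linarith
  rw [abs_le] at h1 hu
  rcases lt_abs.1 h with h2 | h2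
  · constructor <;> intro h3 <;> linarith [h1.1, h1.2, hu.1, hu.2]
  · constructor <;> intro h3 <;> linarith [h1.1, h1.2, hu.1, hu.2]

/-- At the node points the threshold condition is adjacency exactly, since `(m/n) * (z m / m) = z m
/ n`. Moving each point within its cell cannot change the comparison away from the threshold. -/
theorem graphGraphon_eq_prefixGraphon {K n : ℕ} [NeZero K] [NeZero n] {z : ℕ → ℕ}
    (hz : ∀ m, 1 ≤ m → 1 ≤ z m ∧ z m ≤ m) {x y : I} {p q : I × I}
    (hx : nodeLabel K z n (pixelIndex n x) = gridLabel K p)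
    (hy : nodeLabel K z n (pixelIndex n y) = gridLabel K q)
    (hpq : (p, q) ∉ nearThreshold (3 / K)) (hqp : (q, p) ∉ nearThreshold (3 / K)) :
    (graphGraphon (prefixGraph z n)).toFun x y = prefixGraphon.toFun p q := by
  classical
  have key : ∀ (i j : Fin n) (p q : I × I), nodeLabel K z n i = gridLabel K p →
      nodeLabel K z n j = gridLabel K q → (p, q) ∉ nearThreshold (3 / K) →
      (((i : ℕ) + 1 < z (j + 1)) ↔ (p.1 : ℝ) < q.1 * q.2) := by
    intro i j p q hi hj hpq
    obtain ⟨hzi, hzi'⟩ := hz (i + 1) (by omega)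
    obtain ⟨hzj, hzj'⟩ := hz (j + 1) (by omega)
    obtain ⟨h1, -⟩ := near_of_nodeLabel_eq i.2 hzi hzi' hi
    obtain ⟨h2, h3⟩ := near_of_nodeLabel_eq j.2 hzj hzj' hj
    have h4 : 3 * (1 / (K : ℝ)) < |(p.1 : ℝ) - q.1 * q.2| := by
      rw [mul_one_div]
      exact not_le.1 hpq
    have hj0 : (0 : ℝ) < (j : ℕ) + 1 := by positivity
    have hn : (0 : ℝ) < n := by exact_mod_cast NeZero.pos n
    rw [← lt_mul_iff_of_near h1 h2 h3 (by positivity) ((div_le_one hj0).2 (by exact_mod_cast hzj'))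
      q.1.2.1 q.1.2.2 h4]
    have h5 : ((j : ℕ) + 1 : ℝ) / n * (z (j + 1) / ((j : ℕ) + 1)) = z (j + 1) / n := by
      field_simp
    rw [h5, div_lt_div_iff_of_pos_right hn]
    norm_cast
  have hadj : (prefixGraph z n).Adj (pixelIndex n x) (pixelIndex n y) ↔
      ((p.1 : ℝ) < q.1 * q.2 ∨ (q.1 : ℝ) < p.1 * p.2) := by
    rw [← key _ _ _ _ hx hy hpq, ← key _ _ _ _ hy hx hqp]
    have h1 := (hz ((pixelIndex n x : ℕ) + 1) (by omega)).2
    have h2 := (hz ((pixelIndex n y : ℕ) + 1) (by omega)).2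
    -- The requirement that the other node be older is automatic, because `z m ≤ m`.
    simp only [prefixGraph, Fin.lt_def]
    constructor
    · rintro (h | h)
      · exact Or.inl h.2
      · exact Or.inr h.2
    · rintro (h | h)
      · exact Or.inl ⟨by omega, h⟩
      · exact Or.inr ⟨by omega, h⟩
  rw [graphGraphon_apply]
  simp only [hadj, prefixGraphon]

theorem oneNorm_graphGraphon_sub_le {K n : ℕ} [NeZero K] [NeZero n] {z : ℕ → ℕ}
    (hz : ∀ m, 1 ≤ m → 1 ≤ z m ∧ z m ≤ m) (φ : I ≃ᵐ I × I) (hφ : MeasurePreserving φ) :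
    oneNorm (fun x y => (graphGraphon (prefixGraph z n)).toFun x y -
        prefixGraphon.toFun (φ x) (φ y)) ≤
      2 * volume {x | nodeLabel K z n (pixelIndex n x) ≠ gridLabel K (φ x)} +
        2 * ENNReal.ofReal (6 / K) := by
  classical
  set B : Set I := {x | nodeLabel K z n (pixelIndex n x) ≠ gridLabel K (φ x)} with hB
  have hBm : MeasurableSet B := by
    have h1 : Measurable fun x => nodeLabel K z n (pixelIndex n x) :=
      (measurable_of_finite fun i : Fin n => nodeLabel K z n i).comp (measurable_pixelIndex n)
    have h2 : Measurable fun x => gridLabel K (φ x) := (measurable_gridLabel K).comp φ.measurable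
    exact (measurableSet_eq_fun h1 h2).compl
  have hφφ : MeasurePreserving (Prod.map φ φ) (volume : Measure (I × I)) volume := hφ.prod hφ
  set E : Set (I × I) := Prod.map φ φ ⁻¹' nearThreshold (3 / K) with hE
  set E' : Set (I × I) := Prod.swap ⁻¹' E with hE'
  have hEm : MeasurableSet E := hφφ.measurable (measurableSet_nearThreshold _)
  have hEv : volume E ≤ ENNReal.ofReal (6 / K) := by
    rw [hE, hφφ.measure_preimage (measurableSet_nearThreshold _).nullMeasurableSet]
    refine (volume_nearThreshold_le _).trans_eq ?_
    congr 1
    ring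
  have hEv' : volume E' ≤ ENNReal.ofReal (6 / K) := by
    have hs : MeasurePreserving (Prod.swap : I × I → I × I) volume volume :=
      Measure.measurePreserving_swap
    rw [hE', hs.measure_preimage hEm.nullMeasurableSet]
    exact hEv
  -- The difference is at most `1`, and vanishes unless a coordinate is mislabelled (two strips over
  -- `B`) or the pair is near one of the two thresholds, `E` or its reflection `E'`.
  have hpt : ∀ r : I × I, ENNReal.ofReal |(graphGraphon (prefixGraph z n)).toFun r.1 r.2 -
      prefixGraphon.toFun (φ r.1) (φ r.2)| ≤
      ((B ×ˢ Set.univ) ∪ (Set.univ ×ˢ B) ∪ (E ∪ E')).indicator 1 r := by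
    intro r
    set U := graphGraphon (prefixGraph z n)
    by_cases hr : r ∈ (B ×ˢ Set.univ) ∪ (Set.univ ×ˢ B) ∪ (E ∪ E')
    · rw [Set.indicator_of_mem hr, Pi.one_apply, ENNReal.ofReal_le_one, abs_le]
      have h1 := U.nonneg' r.1 r.2
      have h2 := U.le_one' r.1 r.2
      have h3 := prefixGraphon.nonneg' (φ r.1) (φ r.2)
      have h4 := prefixGraphon.le_one' (φ r.1) (φ r.2)
      constructor <;> linarith
    · simp only [Set.mem_union, Set.mem_prod, Set.mem_univ, and_true, true_and, not_or] at hr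
      rw [graphGraphon_eq_prefixGraphon hz (not_not.1 hr.1.1) (not_not.1 hr.1.2) hr.2.1 hr.2.2]
      simp
  refine (lintegral_mono hpt).trans ?_
  rw [lintegral_indicator_one]
  · refine (measure_union_le _ _).trans (add_le_add ?_ ?_)
    · refine (measure_union_le _ _).trans ?_
      rw [Measure.volume_eq_prod, Measure.prod_prod, Measure.prod_prod, measure_univ, mul_one,
        one_mul, two_mul]
    · refine (measure_union_le _ _).trans ?_
      rw [two_mul]
      exact add_le_add hEv hEv'
  · exact ((hBm.prod .univ).union (MeasurableSet.univ.prod hBm)).union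
      (hEm.union (measurable_swap hEm))

/-! ### Measures of label classes -/

theorem volume_real_gridLabel_preimage {K : ℕ} [NeZero K] (a b : Fin K) :
    volume.real (gridLabel K ⁻¹' {(a : ℕ) * K + b}) = 1 / (K : ℝ) ^ 2 := by
  have : gridLabel K ⁻¹' {(a : ℕ) * K + b} =
      (pixelIndex K ⁻¹' {a}) ×ˢ (pixelIndex K ⁻¹' {b}) := by
    ext p
    simp only [gridLabel, Set.mem_preimage, Set.mem_singleton_iff, Set.mem_prod, Fin.ext_iff]
    exact mul_add_eq_mul_add_iff (pixelIndex K p.2).2 b.2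
  rw [this, Measure.volume_eq_prod, measureReal_prod_prod, volume_real_pixelIndex_preimage,
    volume_real_pixelIndex_preimage]
  ring

theorem volume_real_comp_pixelIndex {n : ℕ} [NeZero n] (s : Set ℕ) [DecidablePred (· ∈ s)]
    (g : ℕ → ℕ) :
    volume.real {x : I | g (pixelIndex n x) ∈ s} =
      ((Finset.range n).filter fun i => g i ∈ s).card / (n : ℝ) := by
  have : {x : I | g (pixelIndex n x) ∈ s} =
      ⋃ i ∈ (Finset.univ.filter fun i : Fin n => g i ∈ s), pixelIndex n ⁻¹' {i} := by
    ext x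
    simp
  rw [this, measureReal_biUnion_finset]
  · simp only [volume_real_pixelIndex_preimage, Finset.sum_const, nsmul_eq_mul]
    have h : (Finset.univ.filter fun i : Fin n => g i ∈ s).card =
        ((Finset.range n).filter fun i => g i ∈ s).card := by
      rw [← Nat.Iio_eq_range, ← Fin.map_valEmbedding_univ, Finset.filter_map, Finset.card_map]
      rfl
    rw [h]
    ring
  · intro i _ j _ hij
    exact Disjoint.preimage _ (Set.disjoint_singleton.2 hij)
  · intro i _
    exact measurable_pixelIndex n (measurableSet_singleton i)

/-! ### The law of large numbers for the random choices -/

/-- Hoeffding's inequality bounds the `n`-th exceptional probability by a geometric sequence, and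
Borel–Cantelli concludes. -/
theorem ae_eventually_sum_lt_of_hasSubgaussianMGF {Ω : Type*} [MeasurableSpace Ω] {P : Measure Ω}
    [IsProbabilityMeasure P] {Y : ℕ → Ω → ℝ} (hY : iIndepFun Y P) {c : NNReal} (hc : 0 < c)
    (hsub : ∀ i, HasSubgaussianMGF (Y i) c P) {ε : ℝ} (hε : 0 < ε) :
    ∀ᵐ ω ∂P, ∀ᶠ n : ℕ in atTop, ∑ i ∈ Finset.range n, Y i ω < ε * n := by
  have hc' : (0 : ℝ) < c := hc
  have hbound : ∀ n : ℕ, P {ω | ε * n ≤ ∑ i ∈ Finset.range n, Y i ω} ≤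
      ENNReal.ofReal (Real.exp (n * (-(ε ^ 2 / (2 * c))))) := by
    intro n
    have h := HasSubgaussianMGF.measure_sum_range_ge_le_of_iIndepFun hY (n := n)
      (fun i _ => hsub i) (ε := ε * n) (by positivity)
    have he : -(ε * n) ^ 2 / (2 * n * c) = n * (-(ε ^ 2 / (2 * c))) := by
      rcases eq_or_ne (n : ℝ) 0 with h0 | h0
      · simp [h0]
      · field_simp
    rw [he] at h
    rw [← ofReal_measureReal]
    exact ENNReal.ofReal_le_ofReal h
  have hsum : ∑' n : ℕ, P {ω | ε * n ≤ ∑ i ∈ Finset.range n, Y i ω} ≠ ∞ := by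
    have hs : Summable fun n : ℕ => Real.exp (n * (-(ε ^ 2 / (2 * c)))) :=
      Real.summable_exp_nat_mul_iff.2 (neg_lt_zero.2 (by positivity))
    refine ne_top_of_le_ne_top ?_ (ENNReal.tsum_le_tsum hbound)
    rw [← ENNReal.ofReal_tsum_of_nonneg (fun _ => (Real.exp_pos _).le) hs]
    exact ENNReal.ofReal_ne_top
  filter_upwards [ae_eventually_notMem hsum] with ω hω
  filter_upwards [hω] with n hn
  exact not_le.1 hn

/-- A strong law of large numbers for independent variables with values in `[0,1]`. -/
theorem ae_tendsto_average_of_mem_Icc {Ω : Type*} [MeasurableSpace Ω] {P : Measure Ω}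
    [IsProbabilityMeasure P] {X : ℕ → Ω → ℝ} (hX : iIndepFun X P) (hm : ∀ i, Measurable (X i))
    (hb : ∀ i ω, X i ω ∈ Set.Icc (0 : ℝ) 1) {p : ℝ}
    (hp : Tendsto (fun i => P[X i]) atTop (𝓝 p)) :
    ∀ᵐ ω ∂P, Tendsto (fun n : ℕ => (n : ℝ)⁻¹ * ∑ i ∈ Finset.range n, X i ω) atTop (𝓝 p) := by
  -- Hoeffding's lemma on an interval of length `1`: the parameter `1/4` is the same for all `i`, so
  -- no common distribution is needed.
  have hsub : ∀ i, HasSubgaussianMGF (fun ω => X i ω - P[X i]) ((‖(1 : ℝ) - 0‖₊ / 2) ^ 2) P :=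
    fun i => hasSubgaussianMGF_of_mem_Icc (hm i).aemeasurable (Eventually.of_forall (hb i))
  have hindep : iIndepFun (fun i ω => X i ω - P[X i]) P :=
    hX.comp (fun i (x : ℝ) => x - ∫ ω, X i ω ∂P) fun i => measurable_id.sub_const _
  have hindep' : iIndepFun (fun i => -fun ω => X i ω - P[X i]) P :=
    hindep.comp (fun _ x => -x) fun i => measurable_neg
  have hc : (0 : NNReal) < (‖(1 : ℝ) - 0‖₊ / 2) ^ 2 := by simp
  have h1 : ∀ᵐ ω ∂P, ∀ k : ℕ, ∀ᶠ n : ℕ in atTop,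
      ∑ i ∈ Finset.range n, (X i ω - P[X i]) < 1 / ((k : ℝ) + 1) * n :=
    ae_all_iff.2 fun k =>
      ae_eventually_sum_lt_of_hasSubgaussianMGF hindep hc hsub (by positivity)
  have h2 : ∀ᵐ ω ∂P, ∀ k : ℕ, ∀ᶠ n : ℕ in atTop,
      ∑ i ∈ Finset.range n, (-(X i ω - P[X i])) < 1 / ((k : ℝ) + 1) * n :=
    ae_all_iff.2 fun k =>
      ae_eventually_sum_lt_of_hasSubgaussianMGF hindep' hc (fun i => (hsub i).neg) (by positivity)
  filter_upwards [h1, h2] with ω hω1 hω2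
  have h3 : Tendsto (fun n : ℕ => (n : ℝ)⁻¹ * ∑ i ∈ Finset.range n, (X i ω - P[X i]))
      atTop (𝓝 0) := by
    rw [Metric.tendsto_atTop']
    intro ε hε
    obtain ⟨k, hk⟩ := exists_nat_one_div_lt hε
    obtain ⟨N, hN⟩ := eventually_atTop.1 ((hω1 k).and (hω2 k))
    refine ⟨N, fun n hn => ?_⟩
    obtain ⟨h4, h5⟩ := hN n hn.le
    have hn0 : (0 : ℝ) < n := by
      exact_mod_cast (Nat.zero_le N).trans_lt hn
    rw [Finset.sum_neg_distrib] at h5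
    rw [Real.dist_0_eq_abs, abs_mul, abs_of_pos (inv_pos.2 hn0), inv_mul_lt_iff₀ hn0]
    refine (abs_lt.2 ⟨by linarith, h4⟩).trans ?_
    rw [mul_comm]
    exact mul_lt_mul_of_pos_left hk hn0
  -- The expectations vary with `i`, but their averages converge to `p` by Cesàro.
  have h4 := h3.add hp.cesaro
  rw [zero_add] at h4
  refine h4.congr fun n => ?_
  rw [← mul_add, Finset.sum_sub_distrib, sub_add_cancel]

theorem tendsto_natDiv_div (a : ℕ) {K : ℕ} (hK : 0 < K) :
    Tendsto (fun n : ℕ => ((a * n / K : ℕ) : ℝ) / n) atTop (𝓝 ((a : ℝ) / K)) := by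
  have hK' : (0 : ℝ) < K := by exact_mod_cast hK
  have h1 : Tendsto (fun n : ℕ => (a : ℝ) / K - 1 / n) atTop (𝓝 ((a : ℝ) / K)) := by
    simpa using tendsto_const_nhds.sub (tendsto_one_div_atTop_nhds_zero_nat (𝕜 := ℝ))
  refine tendsto_of_tendsto_of_tendsto_of_le_of_le' h1 tendsto_const_nhds ?_ ?_
  · filter_upwards [eventually_gt_atTop 0] with n hn
    have hn' : (0 : ℝ) < n := by exact_mod_cast hn
    have h2 : (a : ℝ) * n < K * ((a * n / K : ℕ) + 1) := by
      exact_mod_cast Nat.lt_mul_div_succ (a * n) hK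
    rw [sub_le_iff_le_add, ← add_div, div_le_div_iff₀ hK' hn']
    linarith
  · filter_upwards [eventually_gt_atTop 0] with n hn
    have hn' : (0 : ℝ) < n := by exact_mod_cast hn
    have h2 : ((a * n / K : ℕ) : ℝ) * K ≤ a * n := by
      exact_mod_cast Nat.div_mul_le_self (a * n) K
    rw [div_le_div_iff₀ hn' hK']
    exact h2

/-! ### Almost sure equidistribution of the ratios `z m / m` -/

namespace IsPrefixChoice

variable {Ω : Type*} [MeasurableSpace Ω] {P : Measure Ω} [IsProbabilityMeasure P]
  {z : ℕ → Ω → ℕ}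

theorem measureReal_mem_Icc (hz : IsPrefixChoice P z) {n k : ℕ} (hn : 1 ≤ n) (hk : k ≤ n) :
    P.real {ω | z n ω ∈ Finset.Icc 1 k} = k / n := by
  have h : {ω | z n ω ∈ Finset.Icc 1 k} = ⋃ j ∈ Finset.Icc 1 k, z n ⁻¹' {j} := by
    ext ω
    simp
  rw [h, measureReal_biUnion_finset]
  · rw [Finset.sum_congr rfl fun j hj => show P.real (z n ⁻¹' {j}) = 1 / (n : ℝ) from hz.uniform n j (Finset.mem_Icc.1 hj).1
      ((Finset.mem_Icc.1 hj).2.trans hk)]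
    simp [div_eq_mul_inv]
  · intro i _ j _ hij
    exact Disjoint.preimage _ (Set.disjoint_singleton.2 hij)
  · intro j _
    exact hz.measurable n hn (measurableSet_singleton j)

/-- The `m` prescribed masses `1/m` add up to `1`, leaving none for other values. -/
theorem ae_mem_Icc (hz : IsPrefixChoice P z) : ∀ᵐ ω ∂P, ∀ m, 1 ≤ m → 1 ≤ z m ω ∧ z m ω ≤ m := by
  refine ae_all_iff.2 fun m => ?_
  by_cases hm : 1 ≤ m
  · have h1 := hz.measureReal_mem_Icc hm le_rfl
    have hm' : (m : ℝ) ≠ 0 := by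
      have : m ≠ 0 := by omega
      exact_mod_cast this
    rw [div_self hm', measureReal_def, ENNReal.toReal_eq_one_iff] at h1
    have h2 : MeasurableSet {ω | z m ω ∈ Finset.Icc 1 m} :=
      hz.measurable m hm (MeasurableSet.of_discrete (s := {j | j ∈ Finset.Icc 1 m}))
    filter_upwards [(mem_ae_iff_prob_eq_one h2).2 h1] with ω hω _
    exact Finset.mem_Icc.1 hω
  · exact Eventually.of_forall fun ω h => absurd h hm

/-- For `m = i + 1` the condition says `z m ≤ ⌊bm/K⌋`, an event of probability `⌊bm/K⌋ / m → b/K`.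
-/
theorem ae_tendsto_card_filter (hz : IsPrefixChoice P z) {K b : ℕ} (hK : 0 < K) (hb : b ≤ K) :
    ∀ᵐ ω ∂P, Tendsto (fun m : ℕ => (((Finset.range m).filter
      fun i => (z (i + 1) ω * K - 1) / (i + 1) < b).card : ℝ) / m) atTop (𝓝 ((b : ℝ) / K)) := by
  classical
  let s : ℕ → Set ℕ := fun i => {j | j ∈ Finset.Icc 1 (b * (i + 1) / K)}
  let X : ℕ → Ω → ℝ := fun i ω => (s i).indicator 1 (z (i + 1) ω)
  have hXm : ∀ i, Measurable (X i) := fun i =>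
    (measurable_of_countable ((s i).indicator (1 : ℕ → ℝ))).comp (hz.measurable (i + 1) (by omega))
  have hXi : iIndepFun X P := by
    have h1 := hz.indep.precomp (g := fun i : ℕ => (⟨i + 1, by omega⟩ : {n : ℕ // 1 ≤ n}))
      (fun i j h => by simpa using h)
    exact h1.comp (fun i j => (s i).indicator (1 : ℕ → ℝ) j) fun i => measurable_of_countable _
  have hXb : ∀ i ω, X i ω ∈ Set.Icc (0 : ℝ) 1 := by
    intro i ω
    simp only [X, Set.indicator_apply, Pi.one_apply]
    split_ifs <;> simp
  have hXe : ∀ i, P[X i] = ((b * (i + 1) / K : ℕ) : ℝ) / ((i + 1 : ℕ) : ℝ) := by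
    intro i
    have hsm : MeasurableSet {ω | z (i + 1) ω ∈ s i} :=
      hz.measurable (i + 1) (by omega) (MeasurableSet.of_discrete (s := s i))
    have h1 : X i = {ω | z (i + 1) ω ∈ s i}.indicator 1 := by
      ext ω
      simp [X, Set.indicator_apply]
    rw [h1, integral_indicator_one hsm]
    refine hz.measureReal_mem_Icc (by omega) (Nat.div_le_of_le_mul ?_)
    exact Nat.mul_le_mul_right _ hb
  have hp : Tendsto (fun i => P[X i]) atTop (𝓝 ((b : ℝ) / K)) := by
    simp only [hXe]
    exact (tendsto_natDiv_div b hK).comp (tendsto_add_atTop_nat 1)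
  filter_upwards [ae_tendsto_average_of_mem_Icc hXi hXm hXb hp, hz.ae_mem_Icc] with ω hω hzω
  refine hω.congr fun m => ?_
  rw [div_eq_inv_mul, Finset.card_filter, Nat.cast_sum]
  congr 1
  refine Finset.sum_congr rfl fun i _ => ?_
  obtain ⟨h1, h2⟩ := hzω (i + 1) (by omega)
  have h3 : (z (i + 1) ω ∈ s i) ↔ (z (i + 1) ω * K - 1) / (i + 1) < b := by
    have h4 : 0 < z (i + 1) ω * K := Nat.mul_pos h1 hK
    simp only [s, Finset.mem_Icc, Set.mem_ofPred_eq, Nat.le_div_iff_mul_le hK,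
      Nat.div_lt_iff_lt_mul (show 0 < i + 1 by omega)]
    omega
  simp [X, Set.indicator_apply, h3]

end IsPrefixChoice

theorem tendsto_comp_natDiv_div {f : ℕ → ℝ} (hf0 : f 0 = 0) {p : ℝ}
    (hf : Tendsto (fun m : ℕ => f m / m) atTop (𝓝 p)) (a : ℕ) {K : ℕ} (hK : 0 < K) :
    Tendsto (fun n : ℕ => f (a * n / K) / n) atTop (𝓝 (p * (a / K))) := by
  -- For `a = 0` the index `a * n / K` does not tend to infinity. Otherwise the quotient factors as
  -- `(f m / m) * (m / n)` with `m = a * n / K`.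
  rcases Nat.eq_zero_or_pos a with rfl | ha
  · simp [hf0]
  · have hu : Tendsto (fun n : ℕ => a * n / K) atTop atTop :=
      (Nat.tendsto_div_const_atTop hK.ne').comp (tendsto_id.const_mul_atTop' ha)
    refine ((hf.comp hu).mul (tendsto_natDiv_div a hK)).congr fun n => ?_
    simp only [Function.comp_apply]
    rcases Nat.eq_zero_or_pos (a * n / K) with h | h
    · simp [h, hf0]
    · have h' : ((a * n / K : ℕ) : ℝ) ≠ 0 := by exact_mod_cast h.ne'
      rw [div_mul_div_comm, mul_comm, mul_div_mul_left _ _ h']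

/-! ### Equidistribution over the grid and convergence for a fixed sequence -/

section Deterministic

variable {z : ℕ → ℕ} {K : ℕ}

/-- Column `a` consists of the consecutive indices from `a * n / K` up to, but excluding, `(a + 1) *
n / K`, so a cell count is a difference of prefix counts. -/
theorem card_filter_nodeLabel_eq (hz : ∀ m, 1 ≤ m → 1 ≤ z m ∧ z m ≤ m) {a b n : ℕ} (ha : a < K)
    (hb : b < K) (hn : 0 < n) :
    ((Finset.range n).filter fun i => nodeLabel K z n i = a * K + b).card +
      ((Finset.range (a * n / K)).filter fun i => (z (i + 1) * K - 1) / (i + 1) = b).card =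
      ((Finset.range ((a + 1) * n / K)).filter
        fun i => (z (i + 1) * K - 1) / (i + 1) = b).card := by
  have hK : 0 < K := by omega
  have hle : (a + 1) * n / K ≤ n := Nat.div_le_of_le_mul (Nat.mul_le_mul_right _ ha)
  have hle' : a * n / K ≤ (a + 1) * n / K :=
    Nat.div_le_div_right (Nat.mul_le_mul_right _ (Nat.le_succ a))
  have hmem : ∀ i, nodeLabel K z n i = a * K + b ↔
      (a * n / K ≤ i ∧ i < (a + 1) * n / K) ∧ (z (i + 1) * K - 1) / (i + 1) = b := by
    intro i
    obtain ⟨h1, h2⟩ := hz (i + 1) (by omega)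
    rw [nodeLabel, mul_add_eq_mul_add_iff (pred_div_lt hK h1 h2) hb]
    refine and_congr_left fun _ => ?_
    have h3 : 0 < (i + 1) * K := Nat.mul_pos (Nat.succ_pos i) hK
    have h4 : a * n / K ≤ i ↔ a * n < (i + 1) * K := by
      rw [← Nat.div_lt_iff_lt_mul hK, Nat.lt_succ_iff]
    have h5 : i < (a + 1) * n / K ↔ (i + 1) * K ≤ a * n + n := by
      rw [← Nat.succ_le_iff, Nat.le_div_iff_mul_le hK, add_mul, one_mul]
    rw [Nat.div_eq_iff hn, h4, h5]
    omega
  rw [← Finset.card_union_of_disjoint]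
  · congr 1
    ext i
    simp only [Finset.mem_union, Finset.mem_filter, Finset.mem_range, hmem]
    constructor
    · rintro (⟨h1, h2, h3⟩ | ⟨h1, h2⟩)
      · exact ⟨h2.2, h3⟩
      · exact ⟨by omega, h2⟩
    · rintro ⟨h1, h2⟩
      by_cases h3 : i < a * n / K
      · exact Or.inr ⟨h3, h2⟩
      · exact Or.inl ⟨by omega, ⟨by omega, h1⟩, h2⟩
  · rw [Finset.disjoint_left]
    intro i hi hi'
    simp only [Finset.mem_filter, Finset.mem_range, hmem] at hi hi'
    omega

theorem tendsto_card_filter_nodeLabel_eq (hz : ∀ m, 1 ≤ m → 1 ≤ z m ∧ z m ≤ m)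
    (hlim : ∀ b ≤ K, Tendsto (fun m : ℕ => (((Finset.range m).filter
      fun i => (z (i + 1) * K - 1) / (i + 1) < b).card : ℝ) / m) atTop (𝓝 ((b : ℝ) / K)))
    {a b : ℕ} (ha : a < K) (hb : b < K) :
    Tendsto (fun n : ℕ => (((Finset.range n).filter
      fun i => nodeLabel K z n i = a * K + b).card : ℝ) / n) atTop (𝓝 (1 / (K : ℝ) ^ 2)) := by
  have hK : 0 < K := by omega
  have hK' : (K : ℝ) ≠ 0 := by exact_mod_cast hK.ne'
  set M : ℕ → ℝ := fun m => (((Finset.range m).filter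
    fun i => (z (i + 1) * K - 1) / (i + 1) = b).card : ℝ) with hM
  have hM1 : Tendsto (fun m : ℕ => M m / m) atTop (𝓝 (1 / K)) := by
    have h1 := (hlim (b + 1) hb).sub (hlim b hb.le)
    have h2 : ((b + 1 : ℕ) : ℝ) / K - b / K = 1 / K := by
      push_cast
      ring
    rw [h2] at h1
    refine h1.congr fun m => ?_
    rw [← sub_div]
    congr 1
    rw [sub_eq_iff_eq_add]
    simp only [hM]
    norm_cast
    rw [← Finset.card_union_of_disjoint]
    · congr 1
      ext i
      simp only [Finset.mem_union, Finset.mem_filter, Finset.mem_range]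
      omega
    · rw [Finset.disjoint_left]
      intro i hi hi'
      simp only [Finset.mem_filter] at hi hi'
      omega
  have h1 := (tendsto_comp_natDiv_div (f := M) (by simp [hM]) hM1 (a + 1) hK).sub
    (tendsto_comp_natDiv_div (f := M) (by simp [hM]) hM1 a hK)
  have h2 : 1 / (K : ℝ) * ((a + 1 : ℕ) / K) - 1 / K * (a / K) = 1 / (K : ℝ) ^ 2 := by
    push_cast
    field_simp
    ring
  rw [h2] at h1
  refine h1.congr' ?_
  filter_upwards [eventually_gt_atTop 0] with n hn
  rw [← sub_div]
  congr 1
  rw [sub_eq_iff_eq_add]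
  simp only [hM]
  exact_mod_cast (card_filter_nodeLabel_eq hz ha hb hn).symm

/-- The constant sum is kept unevaluated to match, term by term, the limit of the cell frequencies.
-/
theorem volume_real_gridLabel_lt [NeZero K] {c : ℕ} (hc : c ≤ K * K) :
    volume.real {p | gridLabel K p < c} = ∑ _j ∈ Finset.range c, 1 / (K : ℝ) ^ 2 := by
  have h : {p | gridLabel K p < c} = ⋃ j ∈ Finset.range c, gridLabel K ⁻¹' {j} := by
    ext p
    simp
  have hK := NeZero.pos K
  rw [h, measureReal_biUnion_finset]
  · refine Finset.sum_congr rfl fun j hj => ?_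
    have hj' := (Finset.mem_range.1 hj).trans_le hc
    have h1 := volume_real_gridLabel_preimage (K := K)
      ⟨j / K, (Nat.div_lt_iff_lt_mul hK).2 hj'⟩ ⟨j % K, Nat.mod_lt _ hK⟩
    simpa only [Nat.div_add_mod'] using h1
  · intro i _ j _ hij
    exact Disjoint.preimage _ (Set.disjoint_singleton.2 hij)
  · intro j _
    exact measurable_gridLabel K (measurableSet_singleton j)

theorem tendsto_card_filter_nodeLabel_lt [NeZero K] (hz : ∀ m, 1 ≤ m → 1 ≤ z m ∧ z m ≤ m)
    (hlim : ∀ b ≤ K, Tendsto (fun m : ℕ => (((Finset.range m).filter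
      fun i => (z (i + 1) * K - 1) / (i + 1) < b).card : ℝ) / m) atTop (𝓝 ((b : ℝ) / K)))
    {c : ℕ} (hc : c ≤ K * K) :
    Tendsto (fun n : ℕ => (((Finset.range n).filter
      fun i => nodeLabel K z n i < c).card : ℝ) / n) atTop
        (𝓝 (volume.real {p | gridLabel K p < c})) := by
  have hK := NeZero.pos K
  rw [volume_real_gridLabel_lt hc]
  have h1 : ∀ j ∈ Finset.range c, Tendsto (fun n : ℕ => (((Finset.range n).filter
      fun i => nodeLabel K z n i = j).card : ℝ) / n) atTop (𝓝 (1 / (K : ℝ) ^ 2)) := by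
    intro j hj
    have hj' := (Finset.mem_range.1 hj).trans_le hc
    have h2 := tendsto_card_filter_nodeLabel_eq hz hlim
      ((Nat.div_lt_iff_lt_mul hK).2 hj') (Nat.mod_lt j hK)
    simpa only [Nat.div_add_mod'] using h2
  refine (tendsto_finsetSum _ h1).congr fun n => ?_
  rw [← Finset.sum_div]
  congr 1
  have h2 := Finset.card_eq_sum_card_fiberwise (f := nodeLabel K z n)
    (s := (Finset.range n).filter fun i => nodeLabel K z n i < c) (t := Finset.range c)
    (fun i hi => by simpa using (Finset.mem_filter.1 hi).2)
  rw [h2]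
  push_cast
  refine Finset.sum_congr rfl fun j hj => ?_
  rw [Finset.filter_filter]
  congr 2
  refine Finset.filter_congr fun i _ => ?_
  have := Finset.mem_range.1 hj
  omega

theorem editDist_prefixGraph_le [NeZero K] {n : ℕ} [NeZero n]
    (hz : ∀ m, 1 ≤ m → 1 ≤ z m ∧ z m ≤ m) :
    editDist (graphGraphon (prefixGraph z n)) prefixGraphon ≤
      2 * ∑ c ∈ Finset.range (K * K + 1), ENNReal.ofReal
        |(((Finset.range n).filter fun i => nodeLabel K z n i < c).card : ℝ) / n -
          volume.real {p | gridLabel K p < c}| + 2 * ENNReal.ofReal (6 / K) := by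
  have hlt : ∀ x : I, nodeLabel K z n (pixelIndex n x) < K * K := by
    intro x
    set i := (pixelIndex n x).val
    obtain ⟨h1, h2⟩ := hz (i + 1) (by omega)
    have h3 := pred_div_lt (NeZero.pos K) h1 h2
    have h4 : ((i + 1) * K - 1) / n < K :=
      pred_div_lt (NeZero.pos K) (by omega) (pixelIndex n x).2
    calc nodeLabel K z n i < ((i + 1) * K - 1) / n * K + K := Nat.add_lt_add_left h3 _
      _ = (((i + 1) * K - 1) / n + 1) * K := by ring
      _ ≤ K * K := Nat.mul_le_mul_right _ h4
  have hm : Measurable fun x : I => nodeLabel K z n (pixelIndex n x) :=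
    (measurable_of_finite fun i : Fin n => nodeLabel K z n i).comp (measurable_pixelIndex n)
  have hnull : NullSingletonClass (volume : Measure (I × I)) :=
    inferInstanceAs (NullSingletonClass ((volume : Measure I).prod volume))
  obtain ⟨φ, hφ, h⟩ := exists_measurableEquiv_label_ne_le exists_null_not_countable_unitInterval
    exists_null_not_countable_unitSquare hm (measurable_gridLabel K) hlt
  refine (iInf₂_le φ hφ).trans ((oneNorm_graphGraphon_sub_le (K := K) hz φ hφ).trans ?_)
  gcongr
  refine h.trans_eq (Finset.sum_congr rfl fun c _ => ?_)
  have h1 := volume_real_comp_pixelIndex (n := n) (Set.Iio c) (nodeLabel K z n)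
  simp only [Set.mem_Iio] at h1
  rw [h1]

theorem tendsto_editDist_prefixGraph (hz : ∀ m, 1 ≤ m → 1 ≤ z m ∧ z m ≤ m)
    (hlim : ∀ K : ℕ, 0 < K → ∀ b ≤ K, Tendsto (fun m : ℕ => (((Finset.range m).filter
      fun i => (z (i + 1) * K - 1) / (i + 1) < b).card : ℝ) / m) atTop (𝓝 ((b : ℝ) / K))) :
    Tendsto (fun n => editDist (graphGraphon (prefixGraph z n)) prefixGraphon) atTop (𝓝 0) := by
  rw [ENNReal.tendsto_nhds_zero]
  intro ε hε
  have hε2 : 0 < ε / 2 := ENNReal.half_pos hε.ne'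
  have h1 : Tendsto (fun K : ℕ => 2 * ENNReal.ofReal (6 / K)) atTop (𝓝 0) := by
    have h2 := ENNReal.tendsto_ofReal (tendsto_const_div_atTop_nhds_zero_nat (6 : ℝ))
    rw [ENNReal.ofReal_zero] at h2
    simpa using ENNReal.Tendsto.const_mul h2 (Or.inr (by simp : (2 : ℝ≥0∞) ≠ ∞))
  -- The grid is fixed first, making the threshold error at most `ε / 2`; only then does `n` grow,
  -- which removes the finitely many discrepancies.
  obtain ⟨K, hKε, hK⟩ :=
    ((ENNReal.tendsto_nhds_zero.1 h1 _ hε2).and (eventually_gt_atTop 0)).exists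
  have : NeZero K := ⟨hK.ne'⟩
  have h3 : Tendsto (fun n : ℕ => 2 * ∑ c ∈ Finset.range (K * K + 1), ENNReal.ofReal
      |(((Finset.range n).filter fun i => nodeLabel K z n i < c).card : ℝ) / n -
        volume.real {p | gridLabel K p < c}|) atTop (𝓝 0) := by
    have h4 : ∀ c ∈ Finset.range (K * K + 1), Tendsto (fun n : ℕ => ENNReal.ofReal
        |(((Finset.range n).filter fun i => nodeLabel K z n i < c).card : ℝ) / n -
          volume.real {p | gridLabel K p < c}|) atTop (𝓝 0) := by
      intro c hc
      have h5 := tendsto_card_filter_nodeLabel_lt hz (hlim K hK)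
        (Nat.lt_succ_iff.1 (Finset.mem_range.1 hc))
      have h6 := ENNReal.tendsto_ofReal
        ((h5.sub_const (volume.real {p | gridLabel K p < c})).abs)
      simpa using h6
    have h7 := tendsto_finsetSum _ h4
    rw [Finset.sum_const_zero] at h7
    simpa using ENNReal.Tendsto.const_mul h7 (Or.inr (by simp : (2 : ℝ≥0∞) ≠ ∞))
  filter_upwards [ENNReal.tendsto_nhds_zero.1 h3 _ hε2, eventually_gt_atTop 0] with n hn hn0
  have : NeZero n := ⟨hn0.ne'⟩
  refine (editDist_prefixGraph_le (K := K) hz).trans ((add_le_add hn hKε).trans_eq ?_)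
  exact ENNReal.add_halves ε

theorem tendsto_homDensity_of_tendsto_editDist {G : ∀ n : ℕ, SimpleGraph (Fin n)} {α : Type*}
    [MeasureSpace α] [IsProbabilityMeasure (volume : Measure α)] {W : Graphon α}
    (h : Tendsto (fun n => editDist (graphGraphon (G n)) W) atTop (𝓝 0)) {k : ℕ}
    (F : SimpleGraph (Fin k)) :
    Tendsto (fun n => homDensity F (G n)) atTop (𝓝 (graphonDensity F W)) := by
  classical
  rw [tendsto_iff_dist_tendsto_zero]
  have h1 : Tendsto (fun n => (F.edgeFinset.card : ℝ) * (editDist (graphGraphon (G n)) W).toReal)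
      atTop (𝓝 0) := by
    have h2 := (ENNReal.tendsto_toReal ENNReal.zero_ne_top).comp h
    simpa using h2.const_mul (F.edgeFinset.card : ℝ)
  refine squeeze_zero' (Eventually.of_forall fun _ => dist_nonneg) ?_ h1
  -- The edit distance may be `∞` for some `n`; it is eventually finite, as needed for passing to
  -- real numbers.
  filter_upwards [eventually_gt_atTop 0, h.eventually (gt_mem_nhds ENNReal.zero_lt_top)]
    with n hn hfin
  have : NeZero n := ⟨hn.ne'⟩
  rw [← graphonDensity_graphGraphon, Real.dist_eq]
  have h3 := ofReal_abs_graphonDensity_sub_le_editDist F (graphGraphon (G n)) W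
  have h4 := (ENNReal.ofReal_le_iff_le_toReal (by finiteness)).1 h3
  rwa [ENNReal.toReal_mul, ENNReal.toReal_natCast] at h4

end Deterministic

theorem proposition3p3 {Ω : Type*} [MeasurableSpace Ω] (P : Measure Ω) [IsProbabilityMeasure P]
    (z : ℕ → Ω → ℕ) (hz : IsPrefixChoice P z) :
    ∀ᵐ ω ∂P,
      (∀ (k : ℕ) (F : SimpleGraph (Fin k)),
        Tendsto (fun n => homDensity F (prefixGraph (fun m => z m ω) n)) atTop
          (𝓝 (graphonDensity F prefixGraphon))) ∧
      Tendsto (fun n => cutDist (graphGraphon (prefixGraph (fun m => z m ω) n)) prefixGraphon)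
        atTop (𝓝 0) ∧
      Tendsto (fun n => editDist (graphGraphon (prefixGraph (fun m => z m ω) n)) prefixGraphon)
        atTop (𝓝 0) := by
  -- Only countably many pairs `(K, b)` occur, so one null set serves all grids; everything after
  -- this is deterministic.
  have hlim : ∀ᵐ ω ∂P, ∀ K : ℕ, 0 < K → ∀ b ≤ K, Tendsto (fun m : ℕ => (((Finset.range m).filter
      fun i => (z (i + 1) ω * K - 1) / (i + 1) < b).card : ℝ) / m) atTop (𝓝 ((b : ℝ) / K)) := by
    refine ae_all_iff.2 fun K => eventually_imp_distrib_left.2 fun hK => ae_all_iff.2 fun b =>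
      eventually_imp_distrib_left.2 fun hb => hz.ae_tendsto_card_filter hK hb
  filter_upwards [hz.ae_mem_Icc, hlim] with ω hω hωlim
  have h := tendsto_editDist_prefixGraph (z := fun m => z m ω) hω hωlim
  exact ⟨fun k F => tendsto_homDensity_of_tendsto_editDist h F,
    tendsto_of_tendsto_of_tendsto_of_le_of_le tendsto_const_nhds h (fun _ => zero_le)
      fun _ => cutDist_le_editDist _ _, h⟩
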